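/- Let $\mathbb K=\mathbb R$ or $\mathbb C$, let $X\subseteq\mathbb R^m$ and $Y\subseteq\mathbb R^n$ be open, and let $h\in C^\infty(X\times Y)$ (all functions are $\mathbb K$-valued). *Generalized functions.* For $\Omega$ open in some $\mathbb R^d$ put $p_{K,l}(f)=\sup_{x\in K,\,|\alpha|\le l}|\partial^\alpha f(x)|$ for $K\subset\Omega$ compact and $l\in\mathbb N$. Let $\mathcal E_M(\Omega)$ be the algebra of nets $(u_\varepsilon)_{\varepsilon\in(0,1]}$ in $C^\infty(\Omega)$ such that for all $K,l$ there is $N\in\mathbb N$ with $p_{K,l}(u_\varepsilon)=O(\varepsilon^{-N})$ as $\varepsilon\to0$, let $\mathcal I(\Omega)$ be the ideal of nets with $p_{K,l}(u_\varepsilon)=O(\varepsilon^{N})$ for all $K,l,N$, and let $\mathcal G(\Omega)=\mathcal E_M(\Omega)/\mathcal I(\Omega)$; the class of a net is written $Cl(u_\varepsilon)_\varepsilon$. The support of $u\in\mathcal G(\Omega)$ is the complement in $\Omega$ of the union of all open $V\subseteq\Omega$ with $u|_V=0$ in $\mathcal G(V)$, and $\mathcal G_C(\Omega)$ is the set of elements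 with compact support. Let $\sigma:C^\infty(\Omega)\to\mathcal G(\Omega)$, $\sigma(f)=Cl(f)_\varepsilon$. *Classical operator.* Let $\mathcal E'(Y)$ be the topological dual of $C^\infty(Y)$ (the compactly supported distributions) and let $\hat h:\mathcal E'(Y)\to C^\infty(X)$, $\hat h(T)(x)=\langle T,h(x,\cdot)\rangle$. *Embedding.* Fix $\rho\in\mathcal S(\mathbb R^n)$ with $\int\rho=1$ and $\int x^\alpha\rho(x)\,dx=0$ for all $\alpha\in\mathbb N^n\setminus\{0\}$, and put $\rho_\varepsilon(x)=\varepsilon^{-n}\rho(x/\varepsilon)$. For $T\in\mathcal E'(Y)$, $i_S(T)\in\mathcal G(Y)$ is the unique element such that, for every open $V$ with compact closure contained in $Y$ and every $\psi\in\mathcal D(Y)$ with $\psi=1$ on $V$, $i_S(T)|_V=Cl\big(((\psi T)*\rho_\varepsilon)|_V\big)_\varepsilon$. *Generalized integral operator.* For $H\in\mathcal G(X\times Y)$ and $f\in\mathcal G_C(Y)$ put $g=H(\cdot_1,\cdot_2)f(\cdot_2)\in\mathcal G(X\times Y)$. Then $\widehat H(f)=\int_Y H(\cdot,y)f(y)\,dy\in\mathcal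 G(X)$ is the unique element such that for all open $V$, $W$ with compact closures contained in $X$, $Y$ respectively and with $\operatorname{supp} g\cap(V\times Y)\subseteq V\times W$, and for every representative $(g_\varepsilon)_\varepsilon$ of $g$, one has $\widehat H(f)|_V=Cl\big(x\mapsto\int_W g_\varepsilon(x,y)\,dy\big)_\varepsilon$. **Theorem.** The maps $\hat h:\mathcal E'(Y)\to C^\infty(X)$, $i_S:\mathcal E'(Y)\to\mathcal G_C(Y)$ and $\widehat{\sigma(h)}:\mathcal G_C(Y)\to\mathcal G(X)$ are well defined, and the square they form with $\sigma:C^\infty(X)\to\mathcal G(X)$ commutes: $$\sigma\circ\hat h=\widehat{\sigma(h)}\circ i_S .$$ -/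

import Mathlib

open Set TopologicalSpace MeasureTheory
open scoped ContDiff SchwartzMap

namespace Colombeau

section Smooth

variable {E F : Type*} [NormedAddCommGroup E] [NormedSpace ℝ E]
  [NormedAddCommGroup F] [NormedSpace ℝ F]
variable {𝕜 : Type*} [RCLike 𝕜]

open Classical in
/-- Extension by zero of a function defined on the open set `Ω`. It is only used to speak about
derivatives and integrals at points of `Ω`, where the values outside `Ω` play no role. -/
noncomputable def zeroExt {Ω : Opens E} (f : Ω → 𝕜) : E → 𝕜 :=
  fun x => if hx : x ∈ Ω then f ⟨x, hx⟩ else 0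

variable (𝕜) in
/-- The algebra `C^∞(Ω)` of smooth `𝕜`-valued functions on the open set `Ω`. -/
def SmoothFun (Ω : Opens E) : Subalgebra 𝕜 (Ω → 𝕜) where
  carrier := {f | ContDiffOn ℝ ∞ (zeroExt f) Ω}
  mul_mem' := by
    intro f g hf hg
    refine (ContDiffOn.mul hf hg).congr fun x hx => ?_
    have hx' : x ∈ Ω := hx
    simp [zeroExt, hx']
  add_mem' := by
    intro f g hf hg
    refine (ContDiffOn.add hf hg).congr fun x hx => ?_
    have hx' : x ∈ Ω := hx
    simp [zeroExt, hx']
  algebraMap_mem' := by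
    intro c
    refine (contDiffOn_const (c := c)).congr fun x hx => ?_
    have hx' : x ∈ Ω := hx
    simp [zeroExt, hx']

theorem SmoothFun.smoothOn {Ω : Opens E} (f : SmoothFun 𝕜 Ω) :
    ContDiffOn ℝ ∞ (zeroExt (f : Ω → 𝕜)) Ω := f.2

/-- The smooth function on `Ω` defined by a formula that is smooth on `Ω`. -/
def SmoothFun.ofContDiffOn (Ω : Opens E) (f : E → 𝕜) (hf : ContDiffOn ℝ ∞ f Ω) :
    SmoothFun 𝕜 Ω :=
  ⟨fun x => f x, hf.congr fun x hx => by
    have hx' : x ∈ Ω := hx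
    simp [zeroExt, hx']⟩

/-- The seminorm `p_{K,l}(f) = sup_{x ∈ K, k ≤ l} |D^k f(x)|`, as an extended nonnegative number
(it is finite when `K` is a compact subset of `Ω`). -/
noncomputable def semi {Ω : Opens E} (K : Set E) (l : ℕ) (f : SmoothFun 𝕜 Ω) : ENNReal :=
  ⨆ x ∈ K, ⨆ k ∈ Finset.range (l + 1), ‖iteratedFDeriv ℝ k (zeroExt (f : Ω → 𝕜)) x‖ₑ

theorem semi_le_iff {Ω : Opens E} {K : Set E} {l : ℕ} {f : SmoothFun 𝕜 Ω} {B : ℝ} (hB : 0 ≤ B) :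
    semi K l f ≤ ENNReal.ofReal B ↔
      ∀ x ∈ K, ∀ k ≤ l, ‖iteratedFDeriv ℝ k (zeroExt (f : Ω → 𝕜)) x‖ ≤ B := by
  simp only [semi, iSup_le_iff, Finset.mem_range, Nat.lt_succ_iff]
  refine forall_congr' fun x => forall_congr' fun _ => forall_congr' fun k =>
    forall_congr' fun _ => ?_
  rw [← ofReal_norm, ENNReal.ofReal_le_ofReal_iff hB]

theorem iteratedFDeriv_congr_on {Ω : Opens E} {f g : E → 𝕜} (h : ∀ x ∈ Ω, f x = g x) {x : E}
    (hx : x ∈ Ω) (k : ℕ) : iteratedFDeriv ℝ k f x = iteratedFDeriv ℝ k g x := by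
  refine Filter.EventuallyEq.eq_of_nhds (Filter.EventuallyEq.iteratedFDeriv ℝ ?_ k)
  filter_upwards [Ω.isOpen.mem_nhds hx] with y hy using h y hy

theorem contDiffAt_zeroExt {Ω : Opens E} (f : SmoothFun 𝕜 Ω) {x : E} (hx : x ∈ Ω) :
    ContDiffAt ℝ ∞ (zeroExt (f : Ω → 𝕜)) x :=
  (SmoothFun.smoothOn f).contDiffAt (Ω.isOpen.mem_nhds hx)

theorem semi_add_le {Ω : Opens E} {K : Set E} (hK : K ⊆ Ω) (l : ℕ) (f g : SmoothFun 𝕜 Ω)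
    {A B : ℝ} (hA : 0 ≤ A) (hB : 0 ≤ B) (hf : semi K l f ≤ ENNReal.ofReal A)
    (hg : semi K l g ≤ ENNReal.ofReal B) : semi K l (f + g) ≤ ENNReal.ofReal (A + B) := by
  rw [semi_le_iff hA] at hf
  rw [semi_le_iff hB] at hg
  rw [semi_le_iff (add_nonneg hA hB)]
  intro x hx k hk
  have hxΩ : x ∈ Ω := hK hx
  rw [iteratedFDeriv_congr_on (g := zeroExt (f : Ω → 𝕜) + zeroExt (g : Ω → 𝕜))
      (fun y hy => by simp [zeroExt, hy]) hxΩ k,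
    iteratedFDeriv_add_apply ((contDiffAt_zeroExt f hxΩ).of_le (by exact_mod_cast le_top))
      ((contDiffAt_zeroExt g hxΩ).of_le (by exact_mod_cast le_top))]
  exact (norm_add_le _ _).trans (add_le_add (hf x hx k hk) (hg x hx k hk))

theorem semi_mul_le {Ω : Opens E} {K : Set E} (hK : K ⊆ Ω) (l : ℕ) (f g : SmoothFun 𝕜 Ω)
    {A B : ℝ} (hA : 0 ≤ A) (hB : 0 ≤ B) (hf : semi K l f ≤ ENNReal.ofReal A)
    (hg : semi K l g ≤ ENNReal.ofReal B) :
    semi K l (f * g) ≤ ENNReal.ofReal (2 ^ l * (A * B)) := by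
  rw [semi_le_iff hA] at hf
  rw [semi_le_iff hB] at hg
  rw [semi_le_iff (by positivity)]
  intro x hx k hk
  have hxΩ : x ∈ Ω := hK hx
  rw [iteratedFDeriv_congr_on (g := fun y => zeroExt (f : Ω → 𝕜) y * zeroExt (g : Ω → 𝕜) y)
      (fun y hy => by simp [zeroExt, hy]) hxΩ k]
  have key := norm_iteratedFDerivWithin_mul_le (n := k) (SmoothFun.smoothOn f) (SmoothFun.smoothOn g)
    Ω.isOpen.uniqueDiffOn hxΩ (by exact_mod_cast le_top)
  simp only [iteratedFDerivWithin_of_isOpen _ Ω.isOpen hxΩ] at key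
  refine key.trans ?_
  calc _ ≤ ∑ i ∈ Finset.range (k + 1), (k.choose i : ℝ) * (A * B) := by
        refine Finset.sum_le_sum fun i hi => ?_
        have hi' : i ≤ k := Nat.lt_succ_iff.1 (Finset.mem_range.1 hi)
        rw [mul_assoc]
        gcongr
        · exact hf x hx i (hi'.trans hk)
        · exact hg x hx _ ((Nat.sub_le _ _).trans hk)
    _ = 2 ^ k * (A * B) := by
        rw [← Finset.sum_mul]
        norm_cast
        rw [Nat.sum_range_choose]
    _ ≤ 2 ^ l * (A * B) := by
        gcongr
        norm_num

/-- Pull-back `f ↦ f ∘ L` of smooth functions along a continuous linear map `L` that maps `Ω`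
into `Ω'`. For `L = id` this is the restriction to a smaller open set. -/
def SmoothFun.pull (L : E →L[ℝ] F) {Ω : Opens E} {Ω' : Opens F} (hL : ∀ x ∈ Ω, L x ∈ Ω') :
    SmoothFun 𝕜 Ω' →ₐ[𝕜] SmoothFun 𝕜 Ω where
  toFun f := ⟨fun x => f.1 ⟨L x, hL x x.2⟩, by
    refine ((SmoothFun.smoothOn f).comp L.contDiff.contDiffOn hL).congr fun x hx => ?_
    have hx' : x ∈ Ω := hx
    simp [zeroExt, hx', hL x hx']⟩
  map_one' := rfl
  map_mul' _ _ := rfl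
  map_zero' := rfl
  map_add' _ _ := rfl
  commutes' _ := rfl

theorem semi_pull_le (L : E →L[ℝ] F) {Ω : Opens E} {Ω' : Opens F} (hL : ∀ x ∈ Ω, L x ∈ Ω')
    {K : Set E} (hK : K ⊆ Ω) (l : ℕ) (f : SmoothFun 𝕜 Ω') {A : ℝ} (hA : 0 ≤ A)
    (hf : semi (L '' K) l f ≤ ENNReal.ofReal A) :
    semi K l (SmoothFun.pull L hL f) ≤ ENNReal.ofReal ((1 + ‖L‖) ^ l * A) := by
  rw [semi_le_iff hA] at hf
  rw [semi_le_iff (by positivity)]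
  intro x hx k hk
  have hxΩ : x ∈ Ω := hK hx
  have hLx : L x ∈ Ω' := hL x hxΩ
  have hop : IsOpen (L ⁻¹' (Ω' : Set F)) := Ω'.isOpen.preimage L.continuous
  rw [iteratedFDeriv_congr_on (g := zeroExt (f : Ω' → 𝕜) ∘ L)
      (fun y hy => by simp [zeroExt, hy, hL y hy]; rfl) hxΩ k,
    ← iteratedFDerivWithin_of_isOpen k hop (x := x) hLx,
    ContinuousLinearMap.iteratedFDerivWithin_comp_right L (SmoothFun.smoothOn f) Ω'.isOpen.uniqueDiffOn
      hop.uniqueDiffOn hLx (by exact_mod_cast le_top),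
    iteratedFDerivWithin_of_isOpen k Ω'.isOpen hLx]
  refine (ContinuousMultilinearMap.norm_compContinuousLinearMap_le _ _).trans ?_
  have h1 := hf (L x) (mem_image_of_mem L hx) k hk
  have h2 : ∏ _i : Fin k, ‖L‖ ≤ (1 + ‖L‖) ^ l := by
    simp only [Finset.prod_const, Finset.card_univ, Fintype.card_fin]
    calc ‖L‖ ^ k ≤ (1 + ‖L‖) ^ k := by
          gcongr
          linarith
      _ ≤ (1 + ‖L‖) ^ l := by
          gcongr
          linarith [norm_nonneg L]
  rw [mul_comm]
  exact mul_le_mul h2 h1 (norm_nonneg _) (by positivity)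

/-! ### The algebra of simplified generalized functions -/

variable (𝕜) in
/-- Nets `(u_ε)_{ε ∈ (0,1]}` of smooth functions on `Ω`. -/
abbrev Net (Ω : Opens E) : Type _ := Ioc (0 : ℝ) 1 → SmoothFun 𝕜 Ω

/-- Moderate nets: for all `K ⋐ Ω` and `l` there is `N` with
`p_{K,l}(u_ε) = O(ε^{-N})` as `ε → 0`. -/
def IsModerate {Ω : Opens E} (u : Net 𝕜 Ω) : Prop :=
  ∀ K : Set E, IsCompact K → K ⊆ Ω → ∀ l : ℕ, ∃ N : ℕ, ∃ C η : ℝ, 0 ≤ C ∧ 0 < η ∧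
    ∀ ε : Ioc (0 : ℝ) 1, (ε : ℝ) ≤ η → semi K l (u ε) ≤ ENNReal.ofReal (C * ((ε : ℝ) ^ N)⁻¹)

/-- Negligible nets: for all `K ⋐ Ω`, `l` and `N`, `p_{K,l}(u_ε) = O(ε^N)` as `ε → 0`. -/
def IsNegligible {Ω : Opens E} (u : Net 𝕜 Ω) : Prop :=
  ∀ K : Set E, IsCompact K → K ⊆ Ω → ∀ l N : ℕ, ∃ C η : ℝ, 0 ≤ C ∧ 0 < η ∧
    ∀ ε : Ioc (0 : ℝ) 1, (ε : ℝ) ≤ η → semi K l (u ε) ≤ ENNReal.ofReal (C * (ε : ℝ) ^ N)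

theorem isModerate_const {Ω : Opens E} (f : SmoothFun 𝕜 Ω) :
    IsModerate (fun _ : Ioc (0 : ℝ) 1 => f) := by
  intro K hK hKΩ l
  have hb : ∀ k : ℕ, ∃ B : ℝ, 0 ≤ B ∧
      ∀ x ∈ K, ‖iteratedFDeriv ℝ k (zeroExt (f : Ω → 𝕜)) x‖ ≤ B := by
    intro k
    have hc : ContinuousOn (fun x => iteratedFDeriv ℝ k (zeroExt (f : Ω → 𝕜)) x) K := by
      have h1 := (SmoothFun.smoothOn f).continuousOn_iteratedFDerivWithin (m := k)
        (by exact_mod_cast le_top) Ω.isOpen.uniqueDiffOn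
      refine (h1.mono hKΩ).congr fun x hx => ?_
      exact (iteratedFDerivWithin_of_isOpen k Ω.isOpen (hKΩ hx)).symm
    obtain ⟨B, hB⟩ := hK.exists_bound_of_continuousOn hc
    exact ⟨max B 0, le_max_right _ _, fun x hx => (hB x hx).trans (le_max_left _ _)⟩
  choose B hB0 hB using hb
  refine ⟨0, ∑ k ∈ Finset.range (l + 1), B k, 1, Finset.sum_nonneg fun k _ => hB0 k, one_pos,
    fun ε _ => ?_⟩
  rw [semi_le_iff (by simpa using Finset.sum_nonneg fun k _ => hB0 k)]
  intro x hx k hk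
  simp only [pow_zero, inv_one, mul_one]
  exact (hB k x hx).trans (Finset.single_le_sum (f := B) (fun i _ => hB0 i)
    (Finset.mem_range.2 (Nat.lt_succ_iff.2 hk)))

variable (𝕜) in
/-- The algebra `ℰ_M(Ω)` of moderate nets. -/
def Moderate (Ω : Opens E) : Subalgebra 𝕜 (Net 𝕜 Ω) where
  carrier := {u | IsModerate u}
  mul_mem' := by
    intro u v hu hv K hK hKΩ l
    obtain ⟨N, C, η, hC, hη, h⟩ := hu K hK hKΩ l
    obtain ⟨N', C', η', hC', hη', h'⟩ := hv K hK hKΩ l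
    refine ⟨N + N', 2 ^ l * (C * C'), min η η', by positivity, lt_min hη hη', fun ε hε => ?_⟩
    have hε0 : (0 : ℝ) < ε := ε.2.1
    have := semi_mul_le hKΩ l (u ε) (v ε) (by positivity) (by positivity)
      (h ε (hε.trans (min_le_left _ _))) (h' ε (hε.trans (min_le_right _ _)))
    refine this.trans (le_of_eq ?_)
    congr 1
    rw [pow_add]
    field_simp
  add_mem' := by
    intro u v hu hv K hK hKΩ l
    obtain ⟨N, C, η, hC, hη, h⟩ := hu K hK hKΩ l
    obtain ⟨N', C', η', hC', hη', h'⟩ := hv K hK hKΩ l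
    refine ⟨N + N', C + C', min η η', by positivity, lt_min hη hη', fun ε hε => ?_⟩
    have hε0 : (0 : ℝ) < ε := ε.2.1
    have := semi_add_le hKΩ l (u ε) (v ε) (by positivity) (by positivity)
      (h ε (hε.trans (min_le_left _ _))) (h' ε (hε.trans (min_le_right _ _)))
    refine this.trans (ENNReal.ofReal_le_ofReal ?_)
    have h1 : ((ε : ℝ) ^ N)⁻¹ ≤ ((ε : ℝ) ^ (N + N'))⁻¹ :=
      inv_anti₀ (by positivity) (pow_le_pow_of_le_one hε0.le ε.2.2 (by omega))
    have h2 : ((ε : ℝ) ^ N')⁻¹ ≤ ((ε : ℝ) ^ (N + N'))⁻¹ :=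
      inv_anti₀ (by positivity) (pow_le_pow_of_le_one hε0.le ε.2.2 (by omega))
    rw [add_mul]
    gcongr
  algebraMap_mem' := fun c => isModerate_const (algebraMap 𝕜 (SmoothFun 𝕜 _) c)

noncomputable instance (Ω : Opens E) : CommRing (Moderate 𝕜 Ω) := Subalgebra.toCommRing _

variable (𝕜) in
/-- The ideal `ℐ(Ω)` of negligible nets in `ℰ_M(Ω)`. -/
def Negligible (Ω : Opens E) : Ideal (Moderate 𝕜 Ω) where
  carrier := {u | IsNegligible u.1}
  add_mem' := by
    intro u v hu hv K hK hKΩ l N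
    obtain ⟨C, η, hC, hη, h⟩ := hu K hK hKΩ l N
    obtain ⟨C', η', hC', hη', h'⟩ := hv K hK hKΩ l N
    refine ⟨C + C', min η η', by positivity, lt_min hη hη', fun ε hε => ?_⟩
    have hε0 : (0 : ℝ) < ε := ε.2.1
    have := semi_add_le hKΩ l (u.1 ε) (v.1 ε) (by positivity) (by positivity)
      (h ε (hε.trans (min_le_left _ _))) (h' ε (hε.trans (min_le_right _ _)))
    refine this.trans (le_of_eq ?_)
    rw [add_mul]
  zero_mem' := by
    intro K hK hKΩ l N
    refine ⟨0, 1, le_rfl, one_pos, fun ε _ => ?_⟩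
    rw [semi_le_iff (by simp)]
    intro x hx k _
    rw [iteratedFDeriv_congr_on (g := fun _ => (0 : 𝕜)) (fun y hy => by simp [zeroExt])
      (hKΩ hx) k]
    simp [iteratedFDeriv_fun_zero]
  smul_mem' := by
    intro u v hv K hK hKΩ l N
    obtain ⟨M, C, η, hC, hη, h⟩ := u.2 K hK hKΩ l
    obtain ⟨C', η', hC', hη', h'⟩ := hv K hK hKΩ l (N + M)
    refine ⟨2 ^ l * (C * C'), min η η', by positivity, lt_min hη hη', fun ε hε => ?_⟩
    have hε0 : (0 : ℝ) < ε := ε.2.1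
    have := semi_mul_le hKΩ l (u.1 ε) (v.1 ε) (by positivity) (by positivity)
      (h ε (hε.trans (min_le_left _ _))) (h' ε (hε.trans (min_le_right _ _)))
    refine this.trans (le_of_eq ?_)
    congr 1
    rw [pow_add]
    field_simp

variable (𝕜) in
/-- The algebra `𝒢(Ω) = ℰ_M(Ω) / ℐ(Ω)` of simplified generalized functions on `Ω`. -/
def GenFun (Ω : Opens E) : Type _ := Moderate 𝕜 Ω ⧸ Negligible 𝕜 Ω

noncomputable instance (Ω : Opens E) : CommRing (GenFun 𝕜 Ω) :=
  Ideal.Quotient.commRing (Negligible 𝕜 Ω)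

/-- The class `Cl(u_ε)_ε` of a moderate net. -/
noncomputable def cl {Ω : Opens E} : Moderate 𝕜 Ω →+* GenFun 𝕜 Ω :=
  Ideal.Quotient.mk (Negligible 𝕜 Ω)

/-- The canonical embedding `σ : C^∞(Ω) → 𝒢(Ω)`, `f ↦ Cl(f)_ε`. -/
noncomputable def sigma {Ω : Opens E} (f : SmoothFun 𝕜 Ω) : GenFun 𝕜 Ω := cl ⟨fun _ => f, isModerate_const f⟩

/-- Pull-back of moderate nets along a continuous linear map. -/
noncomputable def Moderate.pull (L : E →L[ℝ] F) {Ω : Opens E} {Ω' : Opens F} (hL : ∀ x ∈ Ω, L x ∈ Ω') :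
    Moderate 𝕜 Ω' →+* Moderate 𝕜 Ω where
  toFun u := ⟨fun ε => SmoothFun.pull L hL (u.1 ε), by
    intro K hK hKΩ l
    obtain ⟨N, C, η, hC, hη, h⟩ := u.2 (L '' K) (hK.image L.continuous)
      (image_subset_iff.2 fun x hx => hL x (hKΩ hx)) l
    refine ⟨N, (1 + ‖L‖) ^ l * C, η, by positivity, hη, fun ε hε => ?_⟩
    have hε0 : (0 : ℝ) < ε := ε.2.1
    refine (semi_pull_le L hL hKΩ l (u.1 ε) (by positivity) (h ε hε)).trans (le_of_eq ?_)
    rw [mul_assoc]⟩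
  map_one' := rfl
  map_mul' _ _ := rfl
  map_zero' := rfl
  map_add' _ _ := rfl

/-- Pull-back of generalized functions along a continuous linear map `L` that maps `Ω` into `Ω'`:
`Cl(u_ε)_ε ↦ Cl(u_ε ∘ L)_ε`. -/
noncomputable def GenFun.pull (L : E →L[ℝ] F) {Ω : Opens E} {Ω' : Opens F} (hL : ∀ x ∈ Ω, L x ∈ Ω') :
    GenFun 𝕜 Ω' →+* GenFun 𝕜 Ω :=
  Ideal.quotientMap (Negligible 𝕜 Ω) (Moderate.pull L hL) <| by
    intro u hu K hK hKΩ l N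
    obtain ⟨C, η, hC, hη, h⟩ := hu (L '' K) (hK.image L.continuous)
      (image_subset_iff.2 fun x hx => hL x (hKΩ hx)) l N
    refine ⟨(1 + ‖L‖) ^ l * C, η, by positivity, hη, fun ε hε => ?_⟩
    have hε0 : (0 : ℝ) < ε := ε.2.1
    refine (semi_pull_le L hL hKΩ l (u.1 ε) (by positivity) (h ε hε)).trans (le_of_eq ?_)
    rw [mul_assoc]

/-- Restriction `u ↦ u|_V` of a generalized function on `Ω` to an open set `V ⊆ Ω`. -/
noncomputable def GenFun.restrict {V Ω : Opens E} (hV : V ≤ Ω) : GenFun 𝕜 Ω →+* GenFun 𝕜 V :=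
  GenFun.pull (ContinuousLinearMap.id ℝ E) fun _ hx => hV hx

/-- The support of `u ∈ 𝒢(Ω)`: the complement in `Ω` of the union of the open sets `V ⊆ Ω` with
`u|_V = 0`. -/
def GenFun.supp {Ω : Opens E} (u : GenFun 𝕜 Ω) : Set E :=
  {x | x ∈ Ω ∧ ∀ (V : Opens E) (hV : V ≤ Ω), x ∈ V → GenFun.restrict hV u ≠ 0}

variable (𝕜) in
/-- `𝒢_C(Ω)`: generalized functions on `Ω` with compact support. -/
def CompactGenFun (Ω : Opens E) : Type _ := {u : GenFun 𝕜 Ω // IsCompact u.supp}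

/-- The open set `X × Y`. -/
def prodOpens (X : Opens E) (Y : Opens F) : Opens (E × F) :=
  ⟨(X : Set E) ×ˢ (Y : Set F), X.isOpen.prod Y.isOpen⟩

/-- `V` is a relatively compact open subset of `Ω`. -/
def RelCompact (V Ω : Opens E) : Prop := IsCompact (closure (V : Set E)) ∧ closure (V : Set E) ⊆ Ω

theorem RelCompact.le {V Ω : Opens E} (h : RelCompact V Ω) : V ≤ Ω :=
  fun _ hx => h.2 (subset_closure hx)

variable (𝕜) in
/-- `ℰ'(Ω)`, the topological dual of `C^∞(Ω)`: linear forms `T` with `|T f| ≤ C p_{K,l}(f)` for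
some `K ⋐ Ω`, `l` and `C`. -/
def CompactDistribution (Ω : Opens E) : Type _ :=
  {T : SmoothFun 𝕜 Ω →ₗ[𝕜] 𝕜 // ∃ K : Set E, IsCompact K ∧ K ⊆ Ω ∧ ∃ (l : ℕ) (C : NNReal),
    ∀ f, ‖T f‖ₑ ≤ C * semi K l f}

end Smooth

section Operators

variable {m n : ℕ} {𝕜 : Type*} [RCLike 𝕜]
  {X : Opens (EuclideanSpace ℝ (Fin m))} {Y : Opens (EuclideanSpace ℝ (Fin n))}

/-- The partial function `h(x, ·) ∈ C^∞(Y)` of `h ∈ C^∞(X × Y)`, for `x ∈ X`. -/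
noncomputable def slice (h : SmoothFun 𝕜 (prodOpens X Y)) (x : X) : SmoothFun 𝕜 Y :=
  SmoothFun.ofContDiffOn Y (fun y => zeroExt (h : prodOpens X Y → 𝕜) ((x : EuclideanSpace ℝ (Fin m)), y))
    ((SmoothFun.smoothOn h).comp (contDiff_prodMk_right _).contDiffOn fun _ hy => ⟨x.2, hy⟩)

/-- `A : ℰ'(Y) → C^∞(X)` is the classical operator `ĥ` with kernel `h ∈ C^∞(X × Y)`:
`(A T)(x) = ⟨T, h(x, ·)⟩`. -/
def IsClassicalOperator (h : SmoothFun 𝕜 (prodOpens X Y))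
    (A : CompactDistribution 𝕜 Y → SmoothFun 𝕜 X) : Prop :=
  ∀ (T : CompactDistribution 𝕜 Y) (x : X), (A T : X → 𝕜) x = T.1 (slice h x)

/-- `g ∈ 𝒢(X × Y)`, `G ∈ 𝒢(X)`: `G = ∫_Y g(·, y) dy`. For every relatively compact open `V ⊆ X` and
every relatively compact open `W ⊆ Y` with `supp g ∩ (V × Y) ⊆ V × W`, the restriction of `G` to `V`
is the class of `x ↦ ∫_W g_ε(x, y) dy`, whatever the representative `(g_ε)_ε` of `g`. -/
def IsParamIntegral (g : GenFun 𝕜 (prodOpens X Y)) (G : GenFun 𝕜 X) : Prop :=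
  ∀ (V : Opens (EuclideanSpace ℝ (Fin m))) (hV : RelCompact V X)
    (W : Opens (EuclideanSpace ℝ (Fin n))), RelCompact W Y →
    g.supp ∩ ((V : Set (EuclideanSpace ℝ (Fin m))) ×ˢ (Y : Set (EuclideanSpace ℝ (Fin n)))) ⊆
      (V : Set (EuclideanSpace ℝ (Fin m))) ×ˢ (W : Set (EuclideanSpace ℝ (Fin n))) →
    ∀ u : Moderate 𝕜 (prodOpens X Y), cl u = g →
      ∃ v : Moderate 𝕜 V,
        (∀ (ε : Ioc (0 : ℝ) 1) (x : V), (v.1 ε : V → 𝕜) x =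
          ∫ y in (W : Set (EuclideanSpace ℝ (Fin n))),
            zeroExt (u.1 ε : prodOpens X Y → 𝕜) ((x : EuclideanSpace ℝ (Fin m)), y)) ∧
        GenFun.restrict hV.le G = cl v

variable (X) in
/-- `f ∈ 𝒢(Y)` regarded as the generalized function `(x, y) ↦ f(y)` on `X × Y`. -/
noncomputable def pullSnd (f : GenFun 𝕜 Y) : GenFun 𝕜 (prodOpens X Y) :=
  GenFun.pull (ContinuousLinearMap.snd ℝ (EuclideanSpace ℝ (Fin m)) (EuclideanSpace ℝ (Fin n)))
    (fun _ hx => (mem_prod.1 hx).2) f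

/-- `B : 𝒢_C(Y) → 𝒢(X)` is the generalized integral operator `Ĥ` with kernel `H ∈ 𝒢(X × Y)`:
for every `f ∈ 𝒢_C(Y)` there is exactly one generalized function `∫ H(·, y) f(y) dy` on `X`, and it
is `B f`. -/
def IsGenIntegralOperator (H : GenFun 𝕜 (prodOpens X Y))
    (B : CompactGenFun 𝕜 Y → GenFun 𝕜 X) : Prop :=
  ∀ (f : CompactGenFun 𝕜 Y) (G : GenFun 𝕜 X), IsParamIntegral (H * pullSnd X f.1) G ↔ G = B f

/-- A mollifier: a Schwartz function with integral `1` all of whose moments of positive order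
vanish. -/
def IsMollifier (ρ : 𝓢(EuclideanSpace ℝ (Fin n), 𝕜)) : Prop :=
  ∫ x, ρ x = 1 ∧
    ∀ α : Fin n → ℕ, α ≠ 0 → ∫ x : EuclideanSpace ℝ (Fin n), (∏ i, x i ^ α i) • ρ x = 0

variable (Y) in
/-- The smooth function `y ↦ ρ_ε(x - y)` on `Y`, where `ρ_ε(z) = ε^{-n} ρ(z / ε)`. -/
noncomputable def mollifierAt (ρ : 𝓢(EuclideanSpace ℝ (Fin n), 𝕜)) (ε : Ioc (0 : ℝ) 1)
    (x : EuclideanSpace ℝ (Fin n)) : SmoothFun 𝕜 Y :=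
  SmoothFun.ofContDiffOn Y (fun y => ((ε : ℝ) ^ n)⁻¹ • ρ ((ε : ℝ)⁻¹ • (x - y)))
    (by
      have h1 : ContDiff ℝ ∞ ρ := ρ.smooth ⊤
      fun_prop)

/-- `u ∈ 𝒢(Y)` is the image of `T` under the embedding of distributions built from `ρ`: on every
relatively compact open `V ⊆ Y`, for every cutoff function `ψ ∈ 𝒟(Y)` equal to `1` on `V`, `u` is
represented by the net of regularizations `(ψT) * ρ_ε : x ↦ ⟨T, ψ ρ_ε(x - ·)⟩`. -/
def IsEmbedded (ρ : 𝓢(EuclideanSpace ℝ (Fin n), 𝕜)) (T : CompactDistribution 𝕜 Y)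
    (u : GenFun 𝕜 Y) : Prop :=
  ∀ (V : Opens (EuclideanSpace ℝ (Fin n))) (hV : RelCompact V Y) (ψ : SmoothFun 𝕜 Y),
    HasCompactSupport (ψ : Y → 𝕜) → (∀ y : Y, (y : EuclideanSpace ℝ (Fin n)) ∈ V →
      (ψ : Y → 𝕜) y = 1) →
    ∃ v : Moderate 𝕜 V,
      (∀ (ε : Ioc (0 : ℝ) 1) (x : V), (v.1 ε : V → 𝕜) x = T.1 (ψ * mollifierAt Y ρ ε x)) ∧
      GenFun.restrict hV.le u = cl v

/-- `i` is the embedding `i_S : ℰ'(Y) → 𝒢_C(Y)` built from `ρ`: for every `T` there is exactly one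
generalized function on `Y` that is locally given by regularizations of `T`, and it is `i T`. -/
def IsDistributionEmbedding (ρ : 𝓢(EuclideanSpace ℝ (Fin n), 𝕜))
    (i : CompactDistribution 𝕜 Y → CompactGenFun 𝕜 Y) : Prop :=
  ∀ (T : CompactDistribution 𝕜 Y) (u : GenFun 𝕜 Y), IsEmbedded ρ T u ↔ u = (i T).1

end Operators

end Colombeau

set_option linter.unusedSectionVars false

/-! A distribution `T` bounded by `p_{K,l}` is a continuous functional of the `l`-jets on `K`
(Hahn–Banach, `exists_jet_representation`). So `x ↦ ⟨T, u(x, ·)⟩` is smooth in `x`, with bounds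
depending only on `T` and on the derivatives of `u`, and pairing with `T` preserves moderate and
negligible nets. Integration over a relatively compact `W` is itself such a distribution, so
parameter integrals are pairings too.

Two devices reduce equalities in `𝒢` to estimates of values. A moderate net with rapidly small
values on compact sets is negligible, by interpolation between derivatives
(`isNegligible_of_rapidlySmall`). A generalized function is determined by its restrictions to
relatively compact open sets (`eq_of_restrict_eq`). Since `ρ` is Schwartz, `ρ_ε(x - y)` is rapidly
small off the diagonal. Hence `i_S(T)` has the global representative `x ↦ ⟨T, ρ_ε(x - ·)⟩` without
cutoff, and its support lies in `K`. The parameter integral exists and is unique because enlarging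
`W` beyond the support changes only negligible terms (`isParamIntegral_iff`).

For the square, split `1 = χ + (1 - χ)` with `χ = 1` near `K`. The `1 - χ` part of `∫_W h(x, y) ⟨T,
ρ_ε(y - ·)⟩ dy` is rapidly small. In the other part `T` is exchanged with the integral and `y = z +
s` is substituted, giving `∫ θ_x(s) ρ_ε(s) ds` with `θ_x(s) = ⟨T, (χ h(x, ·))(· + s)⟩`. Taylor
expansion of `θ_x` at `0` and the vanishing moments give `θ_x(0) + O(ε^{N+1})` for every `N`,
uniformly for `x` in compact sets, and `θ_x(0) = ⟨T, h(x, ·)⟩`. -/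

namespace Colombeau

/-! ### Smooth functions of two variables as smooth maps into `C(K, G)`. -/

section ParametricMaps

universe u

/-- For the compact-open topology, joint continuity of the uncurried map is enough; no uniform
estimate is needed. -/
theorem continuousOn_parametric {E E' : Type*} [TopologicalSpace E]
    [TopologicalSpace E'] {Z : Set E} {Y K : Set E'} {G : Type u} [NormedAddCommGroup G] [NormedSpace ℝ G]
    [CompactSpace K] (hK : K ⊆ Y) {F : E × E' → G} (hF : ContinuousOn F (Z ×ˢ Y))
    {Φ : E → C(K, G)} (hΦ : ∀ x ∈ Z, ∀ y : K, Φ x y = F (x, y)) : ContinuousOn Φ Z := by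
  rw [continuousOn_iff_continuous_domRestrict]
  refine ContinuousMap.continuous_of_continuous_uncurry _ ?_
  have : (Function.uncurry fun (x : Z) (y : K) => (Z.domRestrict Φ x) y) =
      fun p : Z × K => F (p.1, p.2) := by
    ext p
    exact hΦ _ p.1.2 _
  rw [this]
  exact hF.comp_continuous (by fun_prop) fun p => ⟨p.1.2, hK p.2.2⟩

theorem exists_parametric {E E' : Type*} [TopologicalSpace E]
    [TopologicalSpace E'] {Z : Set E} {Y K : Set E'} {G : Type u} [NormedAddCommGroup G]
    (hK : K ⊆ Y) {F : E × E' → G} (hF : ContinuousOn F (Z ×ˢ Y)) :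
    ∃ Φ : E → C(K, G), ∀ x ∈ Z, ∀ y : K, Φ x y = F (x, y) := by
  -- The default `0` only serves points outside `Z`, where the slice may fail to be continuous.
  refine ⟨fun x => ContinuousMap.mkD (fun y : K => F (x, y)) 0, fun x hx y => ?_⟩
  rw [ContinuousMap.mkD_apply_of_continuous]
  exact hF.comp_continuous (by fun_prop) fun p => ⟨hx, hK p.2⟩

variable {E E' : Type} [NormedAddCommGroup E] [NormedSpace ℝ E]
  [NormedAddCommGroup E'] [NormedSpace ℝ E']

/-- Swapping of arguments: a continuous family of linear maps is a linear map into continuous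
families. -/
noncomputable def flipContinuousMap {K : Type} [TopologicalSpace K] [CompactSpace K]
    (G : Type u) [NormedAddCommGroup G] [NormedSpace ℝ G] :
    C(K, E →L[ℝ] G) →L[ℝ] (E →L[ℝ] C(K, G)) :=
  LinearMap.mkContinuous₂
    (LinearMap.mk₂ ℝ (fun (ψ : C(K, E →L[ℝ] G)) (v : E) =>
      (⟨fun y => ψ y v, by fun_prop⟩ : C(K, G)))
      (fun _ _ _ => rfl) (fun _ _ _ => rfl)
      (fun _ _ _ => by ext; simp) (fun _ _ _ => by ext; simp)) 1 <| by
    intro ψ v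
    rw [one_mul, ContinuousMap.norm_le _ (by positivity)]
    intro y
    exact (ψ y).le_of_opNorm_le (ψ.norm_coe_le_norm y) v

theorem flipContinuousMap_apply {K : Type} [TopologicalSpace K] [CompactSpace K]
    {G : Type u} [NormedAddCommGroup G] [NormedSpace ℝ G] (ψ : C(K, E →L[ℝ] G)) (v : E) (y : K) :
    flipContinuousMap G ψ v y = ψ y v := rfl

theorem fderiv_partial_fst {G : Type u} [NormedAddCommGroup G] [NormedSpace ℝ G]
    {F : E × E' → G} {x : E} {y : E'} (hF : DifferentiableAt ℝ F (x, y)) :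
    HasFDerivAt (fun x' => F (x', y)) ((fderiv ℝ F (x, y)).comp (.inl ℝ E E')) x :=
  hF.hasFDerivAt.comp x (hasFDerivAt_prodMk_left x y)

variable {Z : Set E} {Y K : Set E'}

/-- The mean value inequality is applied to each slice `F (·, y)`. As `Ψ` is continuous for the sup
norm, one radius `δ` serves all `y ∈ K`, which makes the remainder uniform in `y`. -/
theorem hasFDerivAt_parametric {G : Type u} [NormedAddCommGroup G] [NormedSpace ℝ G]
    [CompactSpace K] (hZ : IsOpen Z) (hY : IsOpen Y) (hK : K ⊆ Y) {F : E × E' → G}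
    (hF : ContDiffOn ℝ ∞ F (Z ×ˢ Y))
    {Φ : E → C(K, G)} (hΦ : ∀ x ∈ Z, ∀ y : K, Φ x y = F (x, y))
    {Ψ : E → C(K, E →L[ℝ] G)}
    (hΨ : ∀ x ∈ Z, ∀ y : K, Ψ x y = (fderiv ℝ F (x, y)).comp (.inl ℝ E E')) {x : E} (hx : x ∈ Z) :
    HasFDerivAt Φ (flipContinuousMap G (Ψ x)) x := by
  have hd : ∀ p ∈ Z ×ˢ Y, DifferentiableAt ℝ F p := fun p hp =>
    (hF.contDiffAt ((hZ.prod hY).mem_nhds hp)).differentiableAt (by simp)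
  have hΨc : ContinuousOn Ψ Z := by
    refine continuousOn_parametric (F := fun p => (fderiv ℝ F p).comp (.inl ℝ E E')) hK ?_ hΨ
    exact (hF.continuousOn_fderiv_of_isOpen (hZ.prod hY) (by simp)).clm_comp continuousOn_const
  rw [hasFDerivAt_iff_isLittleO, Asymptotics.isLittleO_iff]
  intro c hc
  have h1 : ∀ᶠ ξ in nhds x, ‖Ψ ξ - Ψ x‖ < c := by
    filter_upwards [(Metric.continuousAt_iff' (f := Ψ)).1 (hΨc.continuousAt (hZ.mem_nhds hx)) c hc] with ξ hξ
    exact (dist_eq_norm (Ψ ξ) (Ψ x)).symm.trans_lt hξ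
  obtain ⟨δ, hδ, hball⟩ := Metric.eventually_nhds_iff_ball.1 (h1.and (hZ.mem_nhds hx))
  filter_upwards [Metric.ball_mem_nhds x hδ] with ξ hξ
  rw [ContinuousMap.norm_le _ (by positivity)]
  intro y
  have hy : (y : E') ∈ Y := hK y.2
  have key := (convex_ball x δ).norm_image_sub_le_of_norm_hasFDerivWithin_le'
    (f := fun x' => F (x', y)) (φ := Ψ x y) (C := c)
    (fun z hz => (fderiv_partial_fst (hd (z, (y : E')) ⟨(hball z hz).2, hy⟩)).hasFDerivWithinAt)
    (fun z hz => by
      rw [← hΨ z (hball z hz).2 y]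
      exact ((Ψ z - Ψ x).norm_coe_le_norm y).trans (hball z hz).1.le)
    (Metric.mem_ball_self hδ) hξ
  simpa [hΦ x hx, hΦ ξ (hball ξ hξ).2, flipContinuousMap_apply] using key

/-- `G` is quantified inside the induction because the derivative is a parametric map with values in
`E →L[ℝ] G`; `flipContinuousMap` converts it back. -/
theorem contDiffOn_parametric_nat (hZ : IsOpen Z) (hY : IsOpen Y) (hK : K ⊆ Y) [CompactSpace K]
    (n : ℕ) : ∀ {G : Type u} [NormedAddCommGroup G] [NormedSpace ℝ G] {F : E × E' → G}
    (_ : ContDiffOn ℝ ∞ F (Z ×ˢ Y)) {Φ : E → C(K, G)}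
    (_ : ∀ x ∈ Z, ∀ y : K, Φ x y = F (x, y)), ContDiffOn ℝ n Φ Z := by
  induction n with
  | zero =>
    intro G _ _ F hF Φ hΦ
    simpa using continuousOn_parametric hK hF.continuousOn hΦ
  | succ n ih =>
    intro G _ _ F hF Φ hΦ
    have hF1 : ContDiffOn ℝ ∞ (fun p => (fderiv ℝ F p).comp (.inl ℝ E E')) (Z ×ˢ Y) :=
      (hF.fderiv_of_isOpen (hZ.prod hY) (by simp)).clm_comp contDiffOn_const
    obtain ⟨Ψ, hΨ⟩ := exists_parametric (K := K) hK hF1.continuousOn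
    have hder : ∀ x ∈ Z, HasFDerivAt Φ (flipContinuousMap G (Ψ x)) x := fun x hx =>
      hasFDerivAt_parametric hZ hY hK hF hΦ hΨ hx
    push_cast
    rw [contDiffOn_succ_iff_fderiv_of_isOpen hZ]
    refine ⟨fun x hx => (hder x hx).differentiableAt.differentiableWithinAt, by simp, ?_⟩
    have := (flipContinuousMap (E := E) (K := K) G).contDiff.comp_contDiffOn (ih hF1 hΨ)
    exact this.congr fun x hx => (hder x hx).fderiv

/-- A function of two variables that is smooth near `Z × K` defines a smooth map from `Z` into the
Banach space of continuous functions on the compact set `K`. -/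
theorem contDiffOn_parametric (hZ : IsOpen Z) (hY : IsOpen Y) (hK : K ⊆ Y) [CompactSpace K]
    {G : Type u} [NormedAddCommGroup G] [NormedSpace ℝ G] {F : E × E' → G}
    (hF : ContDiffOn ℝ ∞ F (Z ×ˢ Y)) {Φ : E → C(K, G)}
    (hΦ : ∀ x ∈ Z, ∀ y : K, Φ x y = F (x, y)) : ContDiffOn ℝ ∞ Φ Z :=
  contDiffOn_infty.2 fun n => contDiffOn_parametric_nat hZ hY hK n hF hΦ

/-- Evaluation at `y` is continuous and linear, so it commutes with derivatives. Norms in `C(K, G)`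
can then be estimated one `y` at a time. -/
theorem iteratedFDeriv_parametric_apply (hZ : IsOpen Z) (hY : IsOpen Y) (hK : K ⊆ Y)
    [CompactSpace K] {G : Type u} [NormedAddCommGroup G] [NormedSpace ℝ G] {F : E × E' → G}
    (hF : ContDiffOn ℝ ∞ F (Z ×ˢ Y)) {Φ : E → C(K, G)}
    (hΦ : ∀ x ∈ Z, ∀ y : K, Φ x y = F (x, y)) {x : E} (hx : x ∈ Z) (k : ℕ) (v : Fin k → E)
    (y : K) :
    iteratedFDeriv ℝ k Φ x v y = iteratedFDeriv ℝ k (fun x' => F (x', y)) x v := by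
  have h1 := (ContinuousMap.evalCLM ℝ y : C(K, G) →L[ℝ] G).iteratedFDeriv_comp_left (i := k)
    ((contDiffOn_parametric hZ hY hK hF hΦ).contDiffAt (hZ.mem_nhds hx))
    (by exact_mod_cast le_top)
  have h2 : (ContinuousMap.evalCLM ℝ y : C(K, G) →L[ℝ] G) ∘ Φ =ᶠ[nhds x] fun x' => F (x', y) := by
    filter_upwards [hZ.mem_nhds hx] with z hz using hΦ z hz y
  rw [← (h2.iteratedFDeriv ℝ k).eq_of_nhds, h1]
  rfl

theorem iteratedFDeriv_comp_affine {G : Type u} [NormedAddCommGroup G] [NormedSpace ℝ G]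
    {Ω : Set E'} (hΩ : IsOpen Ω) {f : E' → G} (hf : ContDiffOn ℝ ∞ f Ω) (L : E →L[ℝ] E') (a : E')
    {x : E} (hx : L x + a ∈ Ω) (k : ℕ) :
    iteratedFDeriv ℝ k (fun x => f (L x + a)) x =
      (iteratedFDeriv ℝ k f (L x + a)).compContinuousLinearMap fun _ => L := by
  have hΩ' : IsOpen ((· + a) ⁻¹' Ω) := hΩ.preimage (by fun_prop)
  have hf' : ContDiffOn ℝ ∞ (fun y => f (y + a)) ((· + a) ⁻¹' Ω) :=
    hf.comp (by fun_prop) fun _ h => h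
  have hLΩ : IsOpen (L ⁻¹' ((· + a) ⁻¹' Ω)) := hΩ'.preimage L.continuous
  have key := L.iteratedFDerivWithin_comp_right hf' hΩ'.uniqueDiffOn hLΩ.uniqueDiffOn
    (x := x) hx (i := k) (by exact_mod_cast le_top)
  rw [iteratedFDerivWithin_of_isOpen k hLΩ hx, iteratedFDerivWithin_of_isOpen k hΩ' hx,
    iteratedFDeriv_comp_add_right] at key
  exact key

theorem norm_iteratedFDeriv_comp_affine_le {G : Type u} [NormedAddCommGroup G] [NormedSpace ℝ G]
    {Ω : Set E'} (hΩ : IsOpen Ω) {f : E' → G} (hf : ContDiffOn ℝ ∞ f Ω) (L : E →L[ℝ] E') (a : E')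
    {x : E} (hx : L x + a ∈ Ω) (k : ℕ) :
    ‖iteratedFDeriv ℝ k (fun x => f (L x + a)) x‖ ≤
      ‖L‖ ^ k * ‖iteratedFDeriv ℝ k f (L x + a)‖ := by
  rw [iteratedFDeriv_comp_affine hΩ hf L a hx k, mul_comm]
  simpa using ContinuousMultilinearMap.norm_compContinuousLinearMap_le
    (iteratedFDeriv ℝ k f (L x + a)) fun _ => L

theorem iteratedFDeriv_partial_snd {G : Type u} [NormedAddCommGroup G] [NormedSpace ℝ G]
    {Ω : Set (E × E')} (hΩ : IsOpen Ω) {F : E × E' → G} (hF : ContDiffOn ℝ ∞ F Ω)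
    {x : E} {y : E'} (hx : (x, y) ∈ Ω) (k : ℕ) :
    iteratedFDeriv ℝ k (fun y' => F (x, y')) y =
      (iteratedFDeriv ℝ k F (x, y)).compContinuousLinearMap fun _ => .inr ℝ E E' := by
  simpa using iteratedFDeriv_comp_affine hΩ hF (.inr ℝ E E') (x, 0) (x := y) (by simpa using hx) k

/-- Partial derivatives in the first variable are bounded by the full derivatives. -/
theorem norm_iteratedFDeriv_partial_fst_le {G : Type u} [NormedAddCommGroup G] [NormedSpace ℝ G]
    {Ω : Set (E × E')} (hΩ : IsOpen Ω) {F : E × E' → G} (hF : ContDiffOn ℝ ∞ F Ω)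
    {x : E} {y : E'} (hx : (x, y) ∈ Ω) (k : ℕ) :
    ‖iteratedFDeriv ℝ k (fun x' => F (x', y)) x‖ ≤ ‖iteratedFDeriv ℝ k F (x, y)‖ := by
  have h := norm_iteratedFDeriv_comp_affine_le hΩ hF (.inl ℝ E E') (0, y) (x := x)
    (by simpa using hx) k
  simp only [ContinuousLinearMap.inl_apply, Prod.mk_add_mk, add_zero, zero_add] at h
  refine h.trans (mul_le_of_le_one_left (norm_nonneg _) ?_)
  exact pow_le_one₀ (norm_nonneg _) (ContinuousLinearMap.norm_inl_le_one ℝ E E')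

theorem norm_iteratedFDeriv_partial_snd_le {G : Type u} [NormedAddCommGroup G] [NormedSpace ℝ G]
    {Ω : Set (E × E')} (hΩ : IsOpen Ω) {F : E × E' → G} (hF : ContDiffOn ℝ ∞ F Ω)
    {x : E} {y : E'} (hx : (x, y) ∈ Ω) (k : ℕ) :
    ‖iteratedFDeriv ℝ k (fun y' => F (x, y')) y‖ ≤ ‖iteratedFDeriv ℝ k F (x, y)‖ := by
  have h := norm_iteratedFDeriv_comp_affine_le hΩ hF (.inr ℝ E E') (x, 0) (x := y)
    (by simpa using hx) k
  simp only [ContinuousLinearMap.inr_apply, Prod.mk_add_mk, add_zero, zero_add] at h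
  refine h.trans (mul_le_of_le_one_left (norm_nonneg _) ?_)
  exact pow_le_one₀ (norm_nonneg _) (ContinuousLinearMap.norm_inr_le_one ℝ E E')

/-- The two derivatives live in different spaces of multilinear maps, so only norms are compared;
currying isometries remove one order at a time. -/
theorem norm_iteratedFDeriv_iteratedFDeriv {G : Type u} [NormedAddCommGroup G] [NormedSpace ℝ G]
    (f : E → G) (x : E) (j k : ℕ) :
    ‖iteratedFDeriv ℝ k (iteratedFDeriv ℝ j f) x‖ = ‖iteratedFDeriv ℝ (k + j) f x‖ := by
  induction j generalizing k with
  | zero =>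
    have : iteratedFDeriv ℝ 0 f =
      (continuousMultilinearCurryFin0 ℝ E G).symm ∘ f := iteratedFDeriv_zero_eq_comp
    rw [this, LinearIsometryEquiv.norm_iteratedFDeriv_comp_left, add_zero]
  | succ j ih =>
    obtain ⟨I, hI⟩ : ∃ I : (E →L[ℝ] (E [×j]→L[ℝ] G)) ≃ₗᵢ[ℝ] (E [×(j + 1)]→L[ℝ] G),
        iteratedFDeriv ℝ (j + 1) f = I ∘ fderiv ℝ (iteratedFDeriv ℝ j f) :=
      ⟨(continuousMultilinearCurryLeftEquiv ℝ (fun _ : Fin (j + 1) => E) G).symm,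
        iteratedFDeriv_succ_eq_comp_left⟩
    have key := LinearIsometryEquiv.norm_iteratedFDeriv_comp_left (𝕜 := ℝ)
      (F := E →L[ℝ] (E [×j]→L[ℝ] G)) (G := E [×(j + 1)]→L[ℝ] G) I
      (fderiv ℝ (iteratedFDeriv ℝ j f)) x k
    rw [hI, key]
    rw [norm_iteratedFDeriv_fderiv, ih, add_right_comm, add_assoc]

end ParametricMaps

/-! ### Compactly supported distributions as functionals of jets. -/

section Pairing

variable {E E' : Type} [NormedAddCommGroup E] [NormedSpace ℝ E]
  [NormedAddCommGroup E'] [NormedSpace ℝ E'] {𝕜 : Type*} [RCLike 𝕜]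

variable (𝕜 E') in
/-- Jets of order `l` of `𝕜`-valued functions on `E'`. -/
def JetSpace (l : ℕ) : Type _ := ∀ j : Fin (l + 1), E' [×(j : ℕ)]→L[ℝ] 𝕜

noncomputable instance (l : ℕ) : NormedAddCommGroup (JetSpace E' 𝕜 l) :=
  inferInstanceAs (NormedAddCommGroup (∀ j : Fin (l + 1), E' [×(j : ℕ)]→L[ℝ] 𝕜))

noncomputable instance (l : ℕ) : NormedSpace ℝ (JetSpace E' 𝕜 l) :=
  inferInstanceAs (NormedSpace ℝ (∀ j : Fin (l + 1), E' [×(j : ℕ)]→L[ℝ] 𝕜))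

noncomputable instance (l : ℕ) : NormedSpace 𝕜 (JetSpace E' 𝕜 l) :=
  inferInstanceAs (NormedSpace 𝕜 (∀ j : Fin (l + 1), E' [×(j : ℕ)]→L[ℝ] 𝕜))

instance (l : ℕ) : IsScalarTower ℝ 𝕜 (JetSpace E' 𝕜 l) :=
  inferInstanceAs (IsScalarTower ℝ 𝕜 (∀ j : Fin (l + 1), E' [×(j : ℕ)]→L[ℝ] 𝕜))

variable (𝕜 E') in
/-- The `j`-th component of a jet. -/
noncomputable def jetProj (l : ℕ) (j : Fin (l + 1)) :
    JetSpace E' 𝕜 l →L[ℝ] (E' [×(j : ℕ)]→L[ℝ] 𝕜) :=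
  ContinuousLinearMap.proj (R := ℝ) (φ := fun j : Fin (l + 1) => E' [×(j : ℕ)]→L[ℝ] 𝕜) j

theorem JetSpace.ext {l : ℕ} {f g : JetSpace E' 𝕜 l}
    (h : ∀ j, jetProj E' 𝕜 l j f = jetProj E' 𝕜 l j g) :
    f = g := funext h

theorem JetSpace.norm_le_iff {l : ℕ} {f : JetSpace E' 𝕜 l} {B : ℝ} (hB : 0 ≤ B) :
    ‖f‖ ≤ B ↔ ∀ j, ‖jetProj E' 𝕜 l j f‖ ≤ B :=
  pi_norm_le_iff_of_nonneg (x := (f : ∀ j : Fin (l + 1), E' [×(j : ℕ)]→L[ℝ] 𝕜)) hB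

/-- The jet of order `l` of `f` at `y`. -/
noncomputable def jetAt (l : ℕ) (f : E' → 𝕜) (y : E') : JetSpace E' 𝕜 l :=
  fun j => iteratedFDeriv ℝ j f y

theorem zeroExt_apply {E : Type*} [NormedAddCommGroup E] {Ω : Opens E} (f : Ω → 𝕜) {x : E} (hx : x ∈ Ω) :
    zeroExt f x = f ⟨x, hx⟩ := by
  simp [zeroExt, hx]

theorem zeroExt_eventuallyEq {E : Type*} [NormedAddCommGroup E] {Ω : Opens E} {f : Ω → 𝕜}
    {g : E → 𝕜} (h : ∀ x : Ω, f x = g x) {x : E} (hx : x ∈ Ω) : zeroExt f =ᶠ[nhds x] g := by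
  filter_upwards [Ω.isOpen.mem_nhds hx] with y hy
  rw [zeroExt_apply f hy, h]

theorem continuousOn_iteratedFDeriv {G : Type*} [NormedAddCommGroup G] [NormedSpace ℝ G]
    {Ω : Set E'} (hΩ : IsOpen Ω) {f : E' → G}
    (hf : ContDiffOn ℝ ∞ f Ω) (k : ℕ) : ContinuousOn (iteratedFDeriv ℝ k f) Ω :=
  (hf.continuousOn_iteratedFDerivWithin (m := k) (by exact_mod_cast le_top)
    hΩ.uniqueDiffOn).congr fun _ hx => (iteratedFDerivWithin_of_isOpen k hΩ hx).symm

theorem contDiffOn_iteratedFDeriv {G : Type*} [NormedAddCommGroup G] [NormedSpace ℝ G]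
    {Ω : Set E'} (hΩ : IsOpen Ω) {f : E' → G}
    (hf : ContDiffOn ℝ ∞ f Ω) (k : ℕ) : ContDiffOn ℝ ∞ (iteratedFDeriv ℝ k f) Ω := by
  refine contDiffOn_infty.2 fun n x hx => ?_
  have := (hf.contDiffAt (hΩ.mem_nhds hx)).iteratedFDeriv_right (i := k) (m := n)
    (by exact_mod_cast le_top)
  exact this.contDiffWithinAt

theorem continuousOn_jetAt {Y : Opens E'} (l : ℕ) (f : SmoothFun 𝕜 Y) :
    ContinuousOn (jetAt l (zeroExt (f : Y → 𝕜))) Y :=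
  continuousOn_pi.2 fun _ => continuousOn_iteratedFDeriv Y.isOpen (SmoothFun.smoothOn f) _

/-- The family of jets of a smooth function at the points of a compact set. -/
noncomputable def jetMap {Y : Opens E'} {K : Set E'} (hK : K ⊆ Y) (l : ℕ) :
    SmoothFun 𝕜 Y →ₗ[𝕜] C(K, JetSpace E' 𝕜 l) where
  toFun f := ⟨fun y => jetAt l (zeroExt (f : Y → 𝕜)) y,
    (continuousOn_jetAt l f).comp_continuous (by fun_prop) fun y => hK y.2⟩
  map_add' f g := by
    refine ContinuousMap.ext fun y => JetSpace.ext fun j => ?_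
    have hy : (y : E') ∈ Y := hK y.2
    change iteratedFDeriv ℝ j (zeroExt ((f + g : SmoothFun 𝕜 Y) : Y → 𝕜)) y =
      iteratedFDeriv ℝ j (zeroExt (f : Y → 𝕜)) y + iteratedFDeriv ℝ j (zeroExt (g : Y → 𝕜)) y
    rw [← iteratedFDeriv_add_apply ((contDiffAt_zeroExt f hy).of_le (by exact_mod_cast le_top))
      ((contDiffAt_zeroExt g hy).of_le (by exact_mod_cast le_top))]
    exact iteratedFDeriv_congr_on (fun z hz => by simp [zeroExt, hz]) hy j
  map_smul' c f := by
    refine ContinuousMap.ext fun y => JetSpace.ext fun j => ?_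
    have hy : (y : E') ∈ Y := hK y.2
    change iteratedFDeriv ℝ j (zeroExt ((c • f : SmoothFun 𝕜 Y) : Y → 𝕜)) y =
      c • iteratedFDeriv ℝ j (zeroExt (f : Y → 𝕜)) y
    rw [← iteratedFDeriv_const_smul_apply
      ((contDiffAt_zeroExt f hy).of_le (by exact_mod_cast le_top))]
    exact iteratedFDeriv_congr_on (fun z hz => by simp [zeroExt, hz]) hy j

/-- Hence a functional bounded by `p_{K,l}` is controlled by the jets on `K`, which allows it to
factor through `jetMap`. -/
theorem semi_le_norm_jetMap {Y : Opens E'} {K : Set E'} (hK : K ⊆ Y) [CompactSpace K] (l : ℕ)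
    (f : SmoothFun 𝕜 Y) : semi K l f ≤ ENNReal.ofReal ‖jetMap hK l f‖ := by
  rw [semi_le_iff (norm_nonneg (jetMap hK l f))]
  intro x hx k hk
  exact ((JetSpace.norm_le_iff (norm_nonneg _)).1 le_rfl ⟨k, Nat.lt_succ_iff.2 hk⟩).trans
    ((jetMap hK l f).norm_coe_le_norm ⟨x, hx⟩)

theorem norm_apply_le_of_semi_le {Y : Opens E'} {K : Set E'} {l : ℕ} {C : NNReal}
    {T : SmoothFun 𝕜 Y →ₗ[𝕜] 𝕜} (hT : ∀ f, ‖T f‖ₑ ≤ C * semi K l f) {f : SmoothFun 𝕜 Y} {B : ℝ}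
    (hB : 0 ≤ B) (hf : semi K l f ≤ ENNReal.ofReal B) : ‖T f‖ ≤ C * B := by
  rw [← ENNReal.ofReal_le_ofReal_iff (by positivity), ofReal_norm,
    ENNReal.ofReal_mul C.coe_nonneg, ENNReal.ofReal_coe_nnreal]
  exact (hT f).trans (by gcongr)

/-- A distribution of order `l` supported in `K` is a continuous linear functional of the jets of
order `l` on `K`. -/
theorem exists_jet_representation {Y : Opens E'} {K : Set E'} (hK : K ⊆ Y) [CompactSpace K]
    {l : ℕ} {C : NNReal} {T : SmoothFun 𝕜 Y →ₗ[𝕜] 𝕜} (hT : ∀ f, ‖T f‖ₑ ≤ C * semi K l f) :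
    ∃ S : C(K, JetSpace E' 𝕜 l) →L[ℝ] 𝕜, ∀ f, T f = S (jetMap hK l f) := by
  set J : SmoothFun 𝕜 Y →ₗ[𝕜] C(K, JetSpace E' 𝕜 l) := jetMap hK l
  have hTJ : ∀ f, ‖T f‖ ≤ C * ‖J f‖ := fun f =>
    norm_apply_le_of_semi_le hT (norm_nonneg (J f)) (semi_le_norm_jetMap hK l f)
  -- By `hTJ`, `T` vanishes on the kernel of `J`, so it descends to the range of `J`; `R` is a
  -- linear choice of preimages.
  obtain ⟨R, hR⟩ := J.rangeRestrict.exists_rightInverse_of_surjective J.range_rangeRestrict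
  have hJR : ∀ z : LinearMap.range J, J (R z) = z := fun z =>
    congrArg Subtype.val (LinearMap.congr_fun hR z)
  let S₀ : StrongDual 𝕜 (LinearMap.range J) := (T ∘ₗ R).mkContinuous C fun z => by
    have := hTJ (R z)
    rwa [hJR] at this
  -- Hahn–Banach over `𝕜`; afterwards real linearity suffices, since derivatives and integrals are
  -- taken over `ℝ`.
  obtain ⟨S, hS, -⟩ := exists_extension_norm_eq (LinearMap.range J) S₀
  refine ⟨S.restrictScalars ℝ, fun f => ?_⟩
  have h1 : S (J f) = T (R (J.rangeRestrict f)) := hS (J.rangeRestrict f)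
  have h2 : T f - T (R (J.rangeRestrict f)) = 0 := by
    rw [← map_sub, ← norm_le_zero_iff]
    refine (hTJ _).trans (le_of_eq ?_)
    rw [map_sub, hJR]
    simp
  simpa [h1] using sub_eq_zero.1 h2

/-- Equal germs at the points of `K` have equal jets there, and `T` sees nothing else. This locality
stands in for the support of `T`. -/
theorem apply_eq_of_eventuallyEq {Y : Opens E'} {K : Set E'} (hK : K ⊆ Y) {l : ℕ} {C : NNReal}
    {T : SmoothFun 𝕜 Y →ₗ[𝕜] 𝕜} (hT : ∀ f, ‖T f‖ₑ ≤ C * semi K l f) {f g : SmoothFun 𝕜 Y}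
    (h : ∀ y ∈ K, zeroExt (f : Y → 𝕜) =ᶠ[nhds y] zeroExt (g : Y → 𝕜)) : T f = T g := by
  rw [← sub_eq_zero, ← map_sub, ← norm_le_zero_iff]
  refine (norm_apply_le_of_semi_le hT (B := 0) le_rfl ?_).trans (by simp)
  rw [semi_le_iff le_rfl]
  intro y hy k _
  have : zeroExt ((f - g : SmoothFun 𝕜 Y) : Y → 𝕜) =ᶠ[nhds y] fun _ => 0 := by
    filter_upwards [h y hy, Y.isOpen.mem_nhds (hK hy)] with z hz hzY
    have hzY' : z ∈ Y := hzY
    simp only [zeroExt, hzY', dite_true] at hz ⊢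
    exact sub_eq_zero.2 hz
  rw [(this.iteratedFDeriv ℝ k).eq_of_nhds]
  simp [iteratedFDeriv_fun_zero]

/-- The jets in the second variable of a function of two variables. -/
noncomputable def jetSnd (l : ℕ) (F : E × E' → 𝕜) (p : E × E') : JetSpace E' 𝕜 l :=
  fun j => ContinuousMultilinearMap.compContinuousLinearMapL (fun _ => .inr ℝ E E')
    (iteratedFDeriv ℝ j F p)

/-- Jets along the slices are linear images of the full derivatives of `F`, hence depend smoothly on
both variables. -/
theorem jetSnd_eq {Ω : Set (E × E')} (hΩ : IsOpen Ω) {F : E × E' → 𝕜} (hF : ContDiffOn ℝ ∞ F Ω)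
    {x : E} {y : E'} (hx : (x, y) ∈ Ω) (l : ℕ) :
    jetSnd l F (x, y) = jetAt l (fun y' => F (x, y')) y := by
  funext j
  exact (iteratedFDeriv_partial_snd hΩ hF hx j).symm

theorem contDiffOn_jetSnd {Ω : Set (E × E')} (hΩ : IsOpen Ω) {F : E × E' → 𝕜}
    (hF : ContDiffOn ℝ ∞ F Ω) (l : ℕ) : ContDiffOn ℝ ∞ (jetSnd l F) Ω :=
  contDiffOn_pi.2 fun j => (ContinuousMultilinearMap.compContinuousLinearMapL (𝕜 := ℝ)
    (F := 𝕜) (fun _ : Fin j => ContinuousLinearMap.inr ℝ E E')).contDiff.comp_contDiffOn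
      (contDiffOn_iteratedFDeriv hΩ hF j)

/-- The jet norm is a maximum over components, and `k` derivatives of the `j`-th component have
total order `k + j ≤ k + l`. -/
theorem norm_iteratedFDeriv_jetSnd_le {Ω : Set (E × E')} (hΩ : IsOpen Ω) {F : E × E' → 𝕜}
    (hF : ContDiffOn ℝ ∞ F Ω) {p : E × E'} (hp : p ∈ Ω) {k l : ℕ} {B : ℝ} (hB0 : 0 ≤ B)
    (hB : ∀ j ≤ k + l, ‖iteratedFDeriv ℝ j F p‖ ≤ B) :
    ‖iteratedFDeriv ℝ k (jetSnd l F) p‖ ≤ B := by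
  have hcomp : ∀ j : Fin (l + 1), ‖iteratedFDeriv ℝ k (fun q => jetSnd l F q j) p‖ ≤ B := by
    intro j
    refine ((ContinuousMultilinearMap.compContinuousLinearMapL (𝕜 := ℝ) (F := 𝕜)
      (fun _ : Fin j => ContinuousLinearMap.inr ℝ E E')).norm_iteratedFDeriv_comp_left
        ((contDiffOn_iteratedFDeriv hΩ hF j).contDiffAt (hΩ.mem_nhds hp))
        (by exact_mod_cast le_top)).trans ?_
    rw [norm_iteratedFDeriv_iteratedFDeriv]
    refine (mul_le_of_le_one_left (norm_nonneg _) ?_).trans (hB _ (by omega))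
    refine (ContinuousMultilinearMap.norm_compContinuousLinearMapL_le _ _).trans ?_
    exact Finset.prod_le_one (fun _ _ => norm_nonneg _)
      fun _ _ => ContinuousLinearMap.norm_inr_le_one ℝ E E'
  refine ContinuousMultilinearMap.opNorm_le_bound hB0 fun v => ?_
  rw [JetSpace.norm_le_iff (by positivity)]
  intro j
  have h := (jetProj E' 𝕜 l j).iteratedFDeriv_comp_left (i := k)
      ((contDiffOn_jetSnd hΩ hF l).contDiffAt (hΩ.mem_nhds hp)) (by exact_mod_cast le_top)
  have h' : jetProj E' 𝕜 l j (iteratedFDeriv ℝ k (jetSnd l F) p v) =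
      iteratedFDeriv ℝ k (fun q => jetSnd l F q j) p v :=
    (congrArg (fun M => M v) h).symm
  rw [h']
  exact (iteratedFDeriv ℝ k (fun q => jetSnd l F q j) p).le_of_opNorm_le (hcomp j) v

/-- A distribution applied to a smooth family of functions: smoothness in the parameter. -/
theorem contDiffOn_apply {Z : Set E} (hZ : IsOpen Z) {Y : Opens E'} {K : Set E'}
    (hKc : IsCompact K) (hK : K ⊆ Y) {l : ℕ} {C : NNReal} {T : SmoothFun 𝕜 Y →ₗ[𝕜] 𝕜}
    (hT : ∀ f, ‖T f‖ₑ ≤ C * semi K l f) {F : E × E' → 𝕜}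
    (hF : ContDiffOn ℝ ∞ F (Z ×ˢ (Y : Set E'))) {s : E → SmoothFun 𝕜 Y}
    (hs : ∀ x ∈ Z, ∀ y : Y, (s x : Y → 𝕜) y = F (x, y)) :
    ContDiffOn ℝ ∞ (fun x => T (s x)) Z := by
  have : CompactSpace K := isCompact_iff_compactSpace.1 hKc
  obtain ⟨S, hS⟩ := exists_jet_representation hK hT
  have hΩ := hZ.prod Y.isOpen
  have hΦ : ∀ x ∈ Z, ∀ y : K, jetMap hK l (s x) y = jetSnd l F (x, y) := fun x hx y => by
    rw [jetSnd_eq hΩ hF ⟨hx, hK y.2⟩]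
    funext j
    exact ((zeroExt_eventuallyEq (hs x hx) (hK y.2)).iteratedFDeriv ℝ j).eq_of_nhds
  simp only [hS]
  exact S.contDiff.comp_contDiffOn
    (contDiffOn_parametric hZ Y.isOpen hK (contDiffOn_jetSnd hΩ hF l) hΦ)

/-- A distribution applied to a smooth family of functions: bounds for the derivatives in the
parameter. -/
theorem exists_norm_iteratedFDeriv_apply_le {Y : Opens E'} {K : Set E'}
    (hKc : IsCompact K) (hK : K ⊆ Y) {l : ℕ} {C : NNReal} {T : SmoothFun 𝕜 Y →ₗ[𝕜] 𝕜}
    (hT : ∀ f, ‖T f‖ₑ ≤ C * semi K l f) :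
    ∃ A : ℝ, 0 ≤ A ∧ ∀ {Z : Set E} (_ : IsOpen Z) {F : E × E' → 𝕜}
      (_ : ContDiffOn ℝ ∞ F (Z ×ˢ (Y : Set E'))) {s : E → SmoothFun 𝕜 Y}
      (_ : ∀ x ∈ Z, ∀ y : Y, (s x : Y → 𝕜) y = F (x, y)) (k : ℕ) {x : E} (_ : x ∈ Z) {B : ℝ}
      (_ : 0 ≤ B) (_ : ∀ y ∈ K, ∀ j ≤ k + l, ‖iteratedFDeriv ℝ j F (x, y)‖ ≤ B),
      ‖iteratedFDeriv ℝ k (fun x => T (s x)) x‖ ≤ A * B := by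
  have : CompactSpace K := isCompact_iff_compactSpace.1 hKc
  obtain ⟨S, hS⟩ := exists_jet_representation hK hT
  -- `‖S‖` does not depend on the family, so one constant works along a whole net.
  refine ⟨‖S‖, norm_nonneg _, fun {Z} hZ {F} hF {s} hs k {x} hx {B} hB hFB => ?_⟩
  have hΩ := hZ.prod Y.isOpen
  have hΦ : ∀ x ∈ Z, ∀ y : K, jetMap hK l (s x) y = jetSnd l F (x, y) := fun x hx y => by
    rw [jetSnd_eq hΩ hF ⟨hx, hK y.2⟩]
    funext j
    exact ((zeroExt_eventuallyEq (hs x hx) (hK y.2)).iteratedFDeriv ℝ j).eq_of_nhds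
  simp only [hS]
  have hj := contDiffOn_jetSnd hΩ hF l
  refine (S.norm_iteratedFDeriv_comp_left (f := fun x => jetMap hK l (s x))
    ((contDiffOn_parametric hZ Y.isOpen hK hj hΦ).contDiffAt
      (hZ.mem_nhds hx)) (by exact_mod_cast le_top)).trans ?_
  gcongr
  refine ContinuousMultilinearMap.opNorm_le_bound hB fun v => ?_
  rw [ContinuousMap.norm_le _ (by positivity)]
  intro y
  rw [iteratedFDeriv_parametric_apply hZ Y.isOpen hK hj hΦ hx]
  have hbound : ‖iteratedFDeriv ℝ k (fun x' => jetSnd l F (x', (y : E'))) x‖ ≤ B :=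
    (norm_iteratedFDeriv_partial_fst_le hΩ hj ⟨hx, hK y.2⟩ k).trans
      (norm_iteratedFDeriv_jetSnd_le hΩ hF ⟨hx, hK y.2⟩ hB (hFB y y.2))
  exact ContinuousMultilinearMap.le_of_opNorm_le hbound v

end Pairing

/-! ### Pairing a distribution with smooth kernels and with nets of kernels. -/

section KernelPairing

variable {E E' : Type} [NormedAddCommGroup E] [NormedSpace ℝ E]
  [NormedAddCommGroup E'] [NormedSpace ℝ E'] {𝕜 : Type*} [RCLike 𝕜]
  {X : Opens E} {Y : Opens E'}

/-- The partial function `h(x, ·)` of `h ∈ C^∞(X × Y)`. -/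
noncomputable def kernelSlice (h : SmoothFun 𝕜 (prodOpens X Y)) (x : X) : SmoothFun 𝕜 Y :=
  SmoothFun.ofContDiffOn Y (fun y => zeroExt (h : prodOpens X Y → 𝕜) ((x : E), y))
    ((SmoothFun.smoothOn h).comp (contDiff_prodMk_right _).contDiffOn fun _ hy => ⟨x.2, hy⟩)

open Classical in
/-- The partial functions of `h ∈ C^∞(X × Y)`, extended by `0` outside `X`. -/
noncomputable def kernelSliceExt (h : SmoothFun 𝕜 (prodOpens X Y)) (x : E) : SmoothFun 𝕜 Y :=
  if hx : x ∈ X then kernelSlice h ⟨x, hx⟩ else 0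

theorem kernelSlice_apply (h : SmoothFun 𝕜 (prodOpens X Y)) (x : X) (y : Y) :
    (kernelSlice h x : Y → 𝕜) y = zeroExt (h : prodOpens X Y → 𝕜) ((x : E), (y : E')) := rfl

theorem kernelSliceExt_of_mem (h : SmoothFun 𝕜 (prodOpens X Y)) {x : E} (hx : x ∈ X) :
    kernelSliceExt h x = kernelSlice h ⟨x, hx⟩ := dif_pos hx

theorem kernelSliceExt_apply (h : SmoothFun 𝕜 (prodOpens X Y)) :
    ∀ x ∈ (X : Set E), ∀ y : Y,
      (kernelSliceExt h x : Y → 𝕜) y = zeroExt (h : prodOpens X Y → 𝕜) (x, (y : E')) := by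
  intro x hx y
  rw [kernelSliceExt_of_mem h hx, kernelSlice_apply]

/-- Outside `X` both sides vanish because `T 0 = 0`; the pairing becomes a function on all of `E`.
-/
theorem zeroExt_apply_kernelSlice (T : SmoothFun 𝕜 Y →ₗ[𝕜] 𝕜) (h : SmoothFun 𝕜 (prodOpens X Y)) :
    zeroExt (fun x : X => T (kernelSlice h x)) = fun x => T (kernelSliceExt h x) := by
  funext x
  by_cases hx : x ∈ X
  · rw [zeroExt_apply _ hx, kernelSliceExt_of_mem h hx]
  · simp [zeroExt, kernelSliceExt, hx]

/-- The smooth function `x ↦ ⟨T, h(x, ·)⟩` on `X`, for `h ∈ C^∞(X × Y)` and `T ∈ ℰ'(Y)`. -/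
noncomputable def CompactDistribution.pairing (T : CompactDistribution 𝕜 Y)
    (h : SmoothFun 𝕜 (prodOpens X Y)) : SmoothFun 𝕜 X :=
  ⟨fun x => T.1 (kernelSlice h x), by
    obtain ⟨K, hKc, hK, l, C, hT⟩ := T.2
    change ContDiffOn ℝ ∞ (zeroExt _) (X : Set E)
    rw [zeroExt_apply_kernelSlice]
    exact contDiffOn_apply X.isOpen hKc hK hT (SmoothFun.smoothOn h) (kernelSliceExt_apply h)⟩

theorem CompactDistribution.pairing_apply (T : CompactDistribution 𝕜 Y)
    (h : SmoothFun 𝕜 (prodOpens X Y)) (x : X) :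
    (T.pairing h : X → 𝕜) x = T.1 (kernelSlice h x) := rfl

theorem CompactDistribution.zeroExt_pairing (T : CompactDistribution 𝕜 Y)
    (h : SmoothFun 𝕜 (prodOpens X Y)) :
    zeroExt (T.pairing h : X → 𝕜) = fun x => T.1 (kernelSliceExt h x) :=
  zeroExt_apply_kernelSlice T.1 h

/-- `K'`, `l` and `A` depend on `T` alone. Pairing with `T` costs `l` derivatives and a constant, so
it respects powers of `ε`. -/
theorem CompactDistribution.exists_semi_pairing_le (T : CompactDistribution 𝕜 Y) :
    ∃ K' : Set E', IsCompact K' ∧ K' ⊆ Y ∧ ∃ (l : ℕ) (A : ℝ), 0 ≤ A ∧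
      ∀ (h : SmoothFun 𝕜 (prodOpens X Y)) (K : Set E) (_ : K ⊆ X) (k : ℕ) (B : ℝ), 0 ≤ B →
        semi (K ×ˢ K') (k + l) h ≤ ENNReal.ofReal B →
          semi K k (T.pairing h) ≤ ENNReal.ofReal (A * B) := by
  obtain ⟨K', hKc, hK', l, C, hT⟩ := T.2
  obtain ⟨A, hA, h⟩ := exists_norm_iteratedFDeriv_apply_le (E := E) hKc hK' hT
  refine ⟨K', hKc, hK', l, A, hA, fun u K hK k B hB hu => ?_⟩
  rw [semi_le_iff hB] at hu
  rw [semi_le_iff (mul_nonneg hA hB)]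
  intro x hx j hj
  rw [T.zeroExt_pairing]
  exact h X.isOpen (SmoothFun.smoothOn u) (kernelSliceExt_apply u) j (hK hx) hB
    fun y hy i hi => hu (x, y) ⟨hx, hy⟩ i (by omega)

theorem prod_subset_prodOpens {K : Set E} {K' : Set E'} (hK : K ⊆ X) (hK' : K' ⊆ Y) :
    K ×ˢ K' ⊆ (prodOpens X Y : Set (E × E')) := prod_mono hK hK'

/-- The moderate net `x ↦ ⟨T, u_ε(x, ·)⟩`. -/
noncomputable def CompactDistribution.pairingNet (T : CompactDistribution 𝕜 Y)
    (u : Moderate 𝕜 (prodOpens X Y)) : Moderate 𝕜 X :=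
  ⟨fun ε => T.pairing (u.1 ε), by
    obtain ⟨K', hKc, hK', l, A, hA, h⟩ := T.exists_semi_pairing_le (X := X)
    intro K hK hKX k
    obtain ⟨N, C, η, hC, hη, hu⟩ := u.2 _ (hK.prod hKc) (prod_subset_prodOpens hKX hK') (k + l)
    refine ⟨N, A * C, η, by positivity, hη, fun ε hε => ?_⟩
    have hε0 : (0 : ℝ) < ε := ε.2.1
    rw [mul_assoc]
    exact h _ K hKX k _ (by positivity) (hu ε hε)⟩

theorem CompactDistribution.isNegligible_pairing (T : CompactDistribution 𝕜 Y)
    {u : Net 𝕜 (prodOpens X Y)} (hu : IsNegligible u) :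
    IsNegligible fun ε => T.pairing (u ε) := by
  obtain ⟨K', hKc, hK', l, A, hA, h⟩ := T.exists_semi_pairing_le (X := X)
  intro K hK hKX k N
  obtain ⟨C, η, hC, hη, hu⟩ := hu _ (hK.prod hKc) (prod_subset_prodOpens hKX hK') (k + l) N
  refine ⟨A * C, η, by positivity, hη, fun ε hε => ?_⟩
  have hε0 : (0 : ℝ) < ε := ε.2.1
  rw [mul_assoc]
  exact h _ K hKX k _ (by positivity) (hu ε hε)

theorem kernelSlice_sub (h k : SmoothFun 𝕜 (prodOpens X Y)) (x : X) :
    kernelSlice (h - k) x = kernelSlice h x - kernelSlice k x := by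
  refine Subtype.ext (funext fun y => ?_)
  have hy : ((x : E), (y : E')) ∈ prodOpens X Y := ⟨x.2, y.2⟩
  simp [kernelSlice, SmoothFun.ofContDiffOn, zeroExt, hy]

theorem CompactDistribution.pairing_sub (T : CompactDistribution 𝕜 Y)
    (h k : SmoothFun 𝕜 (prodOpens X Y)) : T.pairing (h - k) = T.pairing h - T.pairing k := by
  ext x
  change T.1 _ = T.1 _ - T.1 _
  rw [kernelSlice_sub, map_sub]

end KernelPairing

/-! ### Integration over relatively compact sets as a distribution, and its exchange with `T`. -/

section Integration

variable {E E' : Type} [NormedAddCommGroup E] [NormedSpace ℝ E]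
  [NormedAddCommGroup E'] [NormedSpace ℝ E'] {𝕜 : Type*} [RCLike 𝕜]
  [MeasureSpace E] [BorelSpace E] [IsFiniteMeasureOnCompacts (volume : Measure E)]
  {X : Opens E} {Y : Opens E'}

theorem integrableOn_of_continuousOn {G : Type*} [NormedAddCommGroup G] {S : Set E}
    (hS : IsCompact (closure S)) {f : E → G} (hf : ContinuousOn f (closure S)) : IntegrableOn f S :=
  (hf.integrableOn_compact hS).mono_set subset_closure

/-- The distribution `f ↦ ∫_S f` for a relatively compact measurable set `S`. -/
noncomputable def integralDistribution (S : Set E) (hS : IsCompact (closure S))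
    (hSX : closure S ⊆ X) : CompactDistribution 𝕜 X :=
  ⟨{  toFun := fun f => ∫ x in S, zeroExt (f : X → 𝕜) x
      map_add' := fun f g => by
        rw [← integral_add
          (integrableOn_of_continuousOn hS ((SmoothFun.smoothOn f).continuousOn.mono hSX))
          (integrableOn_of_continuousOn hS ((SmoothFun.smoothOn g).continuousOn.mono hSX))]
        congr 1
        funext x
        by_cases hx : x ∈ X <;> simp [zeroExt, hx]
      map_smul' := fun c f => by
        rw [RingHom.id_apply, ← integral_smul]
        congr 1
        funext x
        by_cases hx : x ∈ X <;> simp [zeroExt, hx] },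
    -- Order `0`, since `|∫_S f| ≤ vol(S) · sup |f|` over `closure S`. All results on pairings
    -- thereby apply to parameter integrals.
    closure S, hS, hSX, 0, (volume S).toNNReal, fun f => by
      have hvol : volume S ≠ ⊤ := ((measure_mono subset_closure).trans_lt hS.measure_lt_top).ne
      rw [ENNReal.coe_toNNReal hvol, mul_comm]
      refine (enorm_integral_le_lintegral_enorm _).trans ?_
      rw [← setLIntegral_const]
      refine setLIntegral_mono measurable_const fun x hx => ?_
      refine le_iSup₂_of_le x (subset_closure hx) (le_iSup₂_of_le 0 (by simp) ?_)
      rw [← ofReal_norm, ← ofReal_norm, norm_iteratedFDeriv_zero]⟩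

theorem integralDistribution_apply {S : Set E} (hS : IsCompact (closure S))
    (hSX : closure S ⊆ X) (f : SmoothFun 𝕜 X) :
    (integralDistribution S hS hSX).1 f = ∫ x in S, zeroExt (f : X → 𝕜) x := rfl

/-- Integration over a relatively compact set as a continuous linear functional. -/
theorem exists_integral_clm {S : Set E} (hS : IsCompact (closure S)) [CompactSpace (closure S)] :
    ∃ I : C(closure S, 𝕜) →L[ℝ] 𝕜, ∀ (φ : C(closure S, 𝕜)) (g : E → 𝕜),
      (∀ x : closure S, φ x = g x) → I φ = ∫ x in S, g x := by
  have hvol : volume S ≠ ⊤ := ((measure_mono subset_closure).trans_lt hS.measure_lt_top).ne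
  set μ : Measure (closure S) := ((volume : Measure E).restrict S).comap Subtype.val with hμ
  have hg : ∀ g : E → 𝕜, ∫ x : closure S, g x ∂μ = ∫ x in S, g x := fun g => by
    rw [hμ, integral_subtype_comap isClosed_closure.measurableSet,
      Measure.restrict_restrict isClosed_closure.measurableSet,
      inter_eq_self_of_subset_right subset_closure]
  have : IsFiniteMeasure μ := by
    refine ⟨?_⟩
    rw [hμ, comap_subtype_coe_apply isClosed_closure.measurableSet]
    refine (measure_mono (subset_univ _)).trans_lt ?_
    simpa using hvol.lt_top
  have hint : ∀ φ : C(closure S, 𝕜), Integrable φ μ := fun φ =>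
    Integrable.of_bound φ.continuous.aestronglyMeasurable ‖φ‖ (.of_forall φ.norm_coe_le_norm)
  let I : C(closure S, 𝕜) →ₗ[ℝ] 𝕜 :=
    { toFun := fun φ => ∫ x, φ x ∂μ
      map_add' := fun φ ψ => integral_add (hint φ) (hint ψ)
      map_smul' := fun c φ => integral_smul c _ }
  refine ⟨I.mkContinuous (μ.real univ) fun φ => ?_, fun φ g h => ?_⟩
  · rw [mul_comm]
    exact norm_integral_le_of_norm_le_const (.of_forall φ.norm_coe_le_norm)
  · rw [← hg]
    exact integral_congr_ae (.of_forall h)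

/-- Differentiation under the integral sign over a relatively compact set. -/
theorem iteratedFDeriv_setIntegral {Z : Set E'} (hZ : IsOpen Z) {S : Set E} (hS : IsCompact (closure S)) (hSX : closure S ⊆ X) {F : E' × E → 𝕜}
    (hF : ContDiffOn ℝ ∞ F (Z ×ˢ (X : Set E))) {z : E'} (hz : z ∈ Z) (k : ℕ) (v : Fin k → E') :
    iteratedFDeriv ℝ k (fun z => ∫ x in S, F (z, x)) z v =
      ∫ x in S, iteratedFDeriv ℝ k (fun z => F (z, x)) z v := by
  have : CompactSpace (closure S) := isCompact_iff_compactSpace.1 hS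
  obtain ⟨I, hI⟩ := exists_integral_clm (𝕜 := 𝕜) hS
  obtain ⟨Φ, hΦ⟩ := exists_parametric hSX hF.continuousOn
  have h1 : (fun z => ∫ x in S, F (z, x)) =ᶠ[nhds z] I ∘ Φ := by
    filter_upwards [hZ.mem_nhds hz] with w hw
    exact (hI _ _ (hΦ w hw)).symm
  rw [(h1.iteratedFDeriv ℝ k).eq_of_nhds, I.iteratedFDeriv_comp_left
    ((contDiffOn_parametric hZ X.isOpen hSX hF hΦ).contDiffAt (hZ.mem_nhds hz))
    (by exact_mod_cast le_top)]
  exact hI _ (fun x => iteratedFDeriv ℝ k (fun z => F (z, x)) z v)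
    (iteratedFDeriv_parametric_apply hZ X.isOpen hSX hF hΦ hz k v)

instance (l : ℕ) : CompleteSpace (JetSpace E' 𝕜 l) :=
  inferInstanceAs (CompleteSpace (∀ j : Fin (l + 1), E' [×(j : ℕ)]→L[ℝ] 𝕜))

/-- Compactly supported distributions commute with integrals of smooth families of functions. -/
theorem CompactDistribution.apply_integral (T : CompactDistribution 𝕜 Y) {S : Set E}
    (hSm : MeasurableSet S) (hS : IsCompact (closure S)) (hSX : closure S ⊆ X) {F : E × E' → 𝕜}
    (hF : ContDiffOn ℝ ∞ F ((X : Set E) ×ˢ (Y : Set E'))) {s : E → SmoothFun 𝕜 Y}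
    (hs : ∀ x ∈ (X : Set E), ∀ y : Y, (s x : Y → 𝕜) y = F (x, y)) {g : SmoothFun 𝕜 Y}
    (hg : ∀ y : Y, (g : Y → 𝕜) y = ∫ x in S, F (x, y)) :
    T.1 g = ∫ x in S, T.1 (s x) := by
  obtain ⟨K, hKc, hK, l, C, hT⟩ := T.2
  have : CompactSpace K := isCompact_iff_compactSpace.1 hKc
  obtain ⟨R, hR⟩ := exists_jet_representation hK hT
  have hΩ := X.isOpen.prod Y.isOpen
  have hΦ : ∀ x ∈ (X : Set E), ∀ y : K, jetMap hK l (s x) y = jetSnd l F (x, y) :=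
    fun x hx y => by
      rw [jetSnd_eq hΩ hF ⟨hx, hK y.2⟩]
      funext j
      exact ((zeroExt_eventuallyEq (hs x hx) (hK y.2)).iteratedFDeriv ℝ j).eq_of_nhds
  -- The jets of `s x` form a continuous curve in the Banach space `C(K, JetSpace E' 𝕜 l)`, so they
  -- can be integrated there and `R` passes under the integral.
  have hint : IntegrableOn (fun x => jetMap hK l (s x)) S :=
    integrableOn_of_continuousOn hS ((continuousOn_parametric hK
      (contDiffOn_jetSnd hΩ hF l).continuousOn hΦ).mono hSX)
  simp only [hR]
  rw [R.integral_comp_comm hint]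
  congr 1
  refine ContinuousMap.ext fun y => JetSpace.ext fun j => ?_
  ext v
  have hy : (y : E') ∈ (Y : Set E') := hK y.2
  -- `Λ` reads one derivative at one point. Such functionals separate points, and for each of them
  -- the claim is differentiation under the integral sign.
  let Λ : C(K, JetSpace E' 𝕜 l) →L[ℝ] 𝕜 :=
    (ContinuousMultilinearMap.apply ℝ (fun _ : Fin j => E') 𝕜 v).comp
      ((jetProj E' 𝕜 l j).comp (ContinuousMap.evalCLM ℝ y))
  have h1 : Λ (∫ x in S, jetMap hK l (s x)) = ∫ x in S, Λ (jetMap hK l (s x)) :=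
    (Λ.integral_comp_comm hint).symm
  refine Eq.trans ?_ h1.symm
  have h2 := iteratedFDeriv_setIntegral Y.isOpen hS hSX (F := fun p : E' × E => F (p.2, p.1))
    (hF.comp (by fun_prop) fun p hp => ⟨hp.2, hp.1⟩) hy j v
  change iteratedFDeriv ℝ j (zeroExt (g : Y → 𝕜)) y v = _
  rw [((zeroExt_eventuallyEq (g := fun y => ∫ x in S, F (x, y)) hg hy).iteratedFDeriv ℝ j).eq_of_nhds, h2]
  refine setIntegral_congr_fun hSm fun x hx => ?_
  change _ = iteratedFDeriv ℝ j (zeroExt (s x : Y → 𝕜)) y v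
  rw [((zeroExt_eventuallyEq (g := fun y => F (x, y)) (hs x (hSX (subset_closure hx))) hy).iteratedFDeriv ℝ j).eq_of_nhds]

end Integration

/-! ### Calculus of `O(ε^N)` estimates on values. -/

section RapidDecay

/-- A net of functions is rapidly small on `S` if it is `O(ε^N)` uniformly on `S`, for all `N`. -/
def RapidlySmall {ι W : Type*} [SeminormedAddCommGroup W] (f : Ioc (0 : ℝ) 1 → ι → W)
    (S : Set ι) : Prop :=
  ∀ N : ℕ, ∃ C η : ℝ, 0 ≤ C ∧ 0 < η ∧
    ∀ ε : Ioc (0 : ℝ) 1, (ε : ℝ) ≤ η → ∀ i ∈ S, ‖f ε i‖ ≤ C * (ε : ℝ) ^ N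

variable {ι W : Type*} [SeminormedAddCommGroup W] {f g : Ioc (0 : ℝ) 1 → ι → W} {S S' : Set ι}

theorem RapidlySmall.empty : RapidlySmall f ∅ :=
  fun _ => ⟨0, 1, le_rfl, one_pos, fun _ _ _ hi => hi.elim⟩

theorem RapidlySmall.mono (hf : RapidlySmall f S) (h : S' ⊆ S) : RapidlySmall f S' := fun N =>
  let ⟨C, η, hC, hη, hb⟩ := hf N
  ⟨C, η, hC, hη, fun ε hε i hi => hb ε hε i (h hi)⟩

theorem RapidlySmall.congr (hf : RapidlySmall f S) (h : ∀ ε, ∀ i ∈ S, f ε i = g ε i) :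
    RapidlySmall g S := fun N =>
  let ⟨C, η, hC, hη, hb⟩ := hf N
  ⟨C, η, hC, hη, fun ε hε i hi => h ε i hi ▸ hb ε hε i hi⟩

theorem RapidlySmall.union (hf : RapidlySmall f S) (hf' : RapidlySmall f S') :
    RapidlySmall f (S ∪ S') := by
  intro N
  obtain ⟨C, η, hC, hη, h⟩ := hf N
  obtain ⟨C', η', hC', hη', h'⟩ := hf' N
  refine ⟨C + C', min η η', by positivity, lt_min hη hη', fun ε hε i hi => ?_⟩
  have hε0 : (0 : ℝ) < ε := ε.2.1
  have h1 : 0 ≤ C * (ε : ℝ) ^ N := by positivity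
  have h2 : 0 ≤ C' * (ε : ℝ) ^ N := by positivity
  rw [add_mul]
  rcases hi with hi | hi
  · linarith [h ε (hε.trans (min_le_left _ _)) i hi]
  · linarith [h' ε (hε.trans (min_le_right _ _)) i hi]

theorem RapidlySmall.add (hf : RapidlySmall f S) (hg : RapidlySmall g S) :
    RapidlySmall (fun ε i => f ε i + g ε i) S := by
  intro N
  obtain ⟨C, η, hC, hη, h⟩ := hf N
  obtain ⟨C', η', hC', hη', h'⟩ := hg N
  refine ⟨C + C', min η η', by positivity, lt_min hη hη', fun ε hε i hi => ?_⟩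
  rw [add_mul]
  exact (norm_add_le _ _).trans (add_le_add (h ε (hε.trans (min_le_left _ _)) i hi)
    (h' ε (hε.trans (min_le_right _ _)) i hi))

/-- Domination by a rapidly small net, up to a fixed polynomial factor in `1/ε`. -/
theorem RapidlySmall.of_le {ι' W' : Type*} [SeminormedAddCommGroup W']
    {g : Ioc (0 : ℝ) 1 → ι' → W'} {S' : Set ι'} (hf : RapidlySmall f S) (A : ℝ) (M : ℕ)
    (hA : 0 ≤ A)
    (h : ∀ (ε : Ioc (0 : ℝ) 1) (B : ℝ), 0 ≤ B → (∀ i ∈ S, ‖f ε i‖ ≤ B) →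
      ∀ i ∈ S', ‖g ε i‖ ≤ A * ((ε : ℝ) ^ M)⁻¹ * B) : RapidlySmall g S' := by
  intro N
  obtain ⟨C, η, hC, hη, hf⟩ := hf (M + N)
  refine ⟨A * C, η, by positivity, hη, fun ε hε i hi => ?_⟩
  have hε0 : (0 : ℝ) < ε := ε.2.1
  refine (h ε _ (by positivity) (hf ε hε) i hi).trans (le_of_eq ?_)
  rw [pow_add]
  field_simp

end RapidDecay

/-! ### Negligibility and equality in `𝒢` tested on values only. -/

section ZerothOrder

variable {E : Type} [NormedAddCommGroup E] [NormedSpace ℝ E] {𝕜 : Type*} [RCLike 𝕜]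
  {Ω : Opens E}

/-- Landau's interpolation inequality: over a step of length `t`, `g` changes by at most `2A`, and
this change differs from the linear one by at most `B t · t`. The free `t` will be a power of `ε`.
-/
theorem norm_fderiv_le_of_bounds {W : Type*} [NormedAddCommGroup W] [NormedSpace ℝ W]
    {g : E → W} {x : E} {r t A B : ℝ} (ht : 0 < t) (htr : t ≤ r)
    (hg : ∀ z ∈ Metric.closedBall x r, ContDiffAt ℝ ∞ g z)
    (hA : ∀ z ∈ Metric.closedBall x r, ‖g z‖ ≤ A)
    (hB : ∀ z ∈ Metric.closedBall x r, ‖fderiv ℝ (fderiv ℝ g) z‖ ≤ B) :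
    ‖fderiv ℝ g x‖ ≤ 2 * A / t + B * t := by
  have hx : x ∈ Metric.closedBall x r := Metric.mem_closedBall_self (ht.le.trans htr)
  have hA0 : 0 ≤ A := (norm_nonneg _).trans (hA x hx)
  have hB0 : 0 ≤ B := (norm_nonneg (fderiv ℝ (fderiv ℝ g) x)).trans (hB x hx)
  have hsub : Metric.closedBall x t ⊆ Metric.closedBall x r := Metric.closedBall_subset_closedBall htr
  have hxt : x ∈ Metric.closedBall x t := Metric.mem_closedBall_self ht.le
  have h1 : ∀ z ∈ Metric.closedBall x t, ‖fderiv ℝ g z - fderiv ℝ g x‖ ≤ B * t := by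
    intro z hz
    have := (convex_closedBall x t).norm_image_sub_le_of_norm_hasFDerivWithin_le
      (f := fderiv ℝ g) (f' := fderiv ℝ (fderiv ℝ g)) (C := B)
      (fun w hw => (((hg w (hsub hw)).fderiv_right (m := ∞)
        (by simp)).differentiableAt (by simp)).hasFDerivAt.hasFDerivWithinAt)
      (fun w hw => hB w (hsub hw)) hxt hz
    refine this.trans ?_
    gcongr
    simpa [dist_eq_norm] using hz
  have h2 : ∀ w : E, ‖w‖ = t → ‖fderiv ℝ g x w‖ ≤ 2 * A + B * t * t := by
    intro w hw
    have hxw : x + w ∈ Metric.closedBall x t := by simp [hw]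
    have := (convex_closedBall x t).norm_image_sub_le_of_norm_hasFDerivWithin_le'
      (f := g) (f' := fderiv ℝ g) (C := B * t) (φ := fderiv ℝ g x)
      (fun w hw => ((hg w (hsub hw)).differentiableAt (by simp)).hasFDerivAt.hasFDerivWithinAt)
      h1 hxt hxw
    rw [add_sub_cancel_left, hw] at this
    have h3 := norm_sub_norm_le (fderiv ℝ g x w) (g (x + w) - g x)
    rw [norm_sub_rev (fderiv ℝ g x w)] at h3
    have h4 := norm_sub_le (g (x + w)) (g x)
    linarith [hA _ (hsub hxw), hA x hx]
  refine ContinuousLinearMap.opNorm_le_bound _ (by positivity) fun v => ?_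
  rcases eq_or_ne v 0 with rfl | hv
  · simp
  have hv0 : 0 < ‖v‖ := norm_pos_iff.2 hv
  have h5 := h2 ((t / ‖v‖) • v) (by
    rw [norm_smul, Real.norm_of_nonneg (by positivity)]
    field_simp)
  rw [map_smul, norm_smul, Real.norm_of_nonneg (by positivity), div_mul_eq_mul_div,
    div_le_iff₀ hv0] at h5
  rw [← mul_le_mul_iff_right₀ ht]
  refine h5.trans (le_of_eq ?_)
  field_simp

/-- A moderate net all of whose values are rapidly small on compact sets is negligible. -/
theorem isNegligible_of_rapidlySmall [ProperSpace E] {u : Net 𝕜 Ω} (hu : IsModerate u)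
    (h0 : ∀ K : Set E, IsCompact K → K ⊆ Ω →
      RapidlySmall (fun ε x => zeroExt (u ε : Ω → 𝕜) x) K) : IsNegligible u := by
  suffices H : ∀ (l : ℕ) (K : Set E), IsCompact K → K ⊆ Ω → ∀ N : ℕ, ∃ C η : ℝ, 0 ≤ C ∧ 0 < η ∧
      ∀ ε : Ioc (0 : ℝ) 1, (ε : ℝ) ≤ η → ∀ x ∈ K, ∀ k ≤ l,
        ‖iteratedFDeriv ℝ k (zeroExt (u ε : Ω → 𝕜)) x‖ ≤ C * (ε : ℝ) ^ N by
    intro K hK hKΩ l N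
    obtain ⟨C, η, hC, hη, h⟩ := H l K hK hKΩ N
    refine ⟨C, η, hC, hη, fun ε hε => ?_⟩
    have hε0 : (0 : ℝ) < ε := ε.2.1
    rw [semi_le_iff (by positivity)]
    exact h ε hε
  intro l
  induction l with
  | zero =>
    intro K hK hKΩ N
    obtain ⟨C, η, hC, hη, h⟩ := h0 K hK hKΩ N
    refine ⟨C, η, hC, hη, fun ε hε x hx k hk => ?_⟩
    rw [Nat.le_zero.1 hk, norm_iteratedFDeriv_zero]
    exact h ε hε x hx
  | succ l ih =>
    intro K hK hKΩ N
    -- A margin around `K` inside `Ω` leaves room for the interpolation step.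
    obtain ⟨r, hr, hrΩ⟩ := hK.exists_cthickening_subset_open Ω.isOpen hKΩ
    have hL : IsCompact (Metric.cthickening r K) := hK.cthickening
    obtain ⟨M, C₂, η₂, hC₂, hη₂, h₂⟩ := hu _ hL hrΩ (l + 2)
    -- With second-order bound `C₂ ε^{-M}` and step `t = r ε^{M+N}`, the term `B t` is `C₂ r ε^N`.
    -- The exponent `M + N + N` makes `2A / t` equal to `(2 C₁ / r) ε^N`.
    obtain ⟨C₁, η₁, hC₁, hη₁, h₁⟩ := ih _ hL hrΩ (M + N + N)
    obtain ⟨C₃, η₃, hC₃, hη₃, h₃⟩ := ih K hK hKΩ N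
    refine ⟨C₃ + (2 * C₁ / r + C₂ * r), min η₃ (min η₁ η₂), by positivity,
      lt_min hη₃ (lt_min hη₁ hη₂), fun ε hε x hx k hk => ?_⟩
    have hε0 : (0 : ℝ) < ε := ε.2.1
    have hεN : 0 < (ε : ℝ) ^ N := by positivity
    rcases hk.lt_or_eq with hk | rfl
    · refine (h₃ ε (hε.trans (min_le_left _ _)) x hx k (Nat.lt_succ_iff.1 hk)).trans ?_
      gcongr
      exact le_add_of_nonneg_right (by positivity)
    · have hball : Metric.closedBall x r ⊆ Metric.cthickening r K :=
        Metric.closedBall_subset_cthickening hx r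
      have h₂' := (semi_le_iff (by positivity)).1
        (h₂ ε ((hε.trans (min_le_right _ _)).trans (min_le_right _ _)))
      have h₁' := h₁ ε ((hε.trans (min_le_right _ _)).trans (min_le_left _ _))
      have ht : 0 < r * (ε : ℝ) ^ (M + N) := by positivity
      have key := norm_fderiv_le_of_bounds
        (g := iteratedFDeriv ℝ l (zeroExt (u ε : Ω → 𝕜))) (x := x) (r := r)
        (t := r * (ε : ℝ) ^ (M + N)) (A := C₁ * (ε : ℝ) ^ (M + N + N))
        (B := C₂ * ((ε : ℝ) ^ M)⁻¹) ht
        (mul_le_of_le_one_right hr.le (pow_le_one₀ hε0.le ε.2.2))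
        (fun z hz => (contDiffOn_iteratedFDeriv Ω.isOpen (SmoothFun.smoothOn (u ε)) l).contDiffAt
          (Ω.isOpen.mem_nhds (hrΩ (hball hz))))
        (fun z hz => h₁' z (hball hz) l le_rfl)
        (fun z hz => by
          rw [← norm_iteratedFDeriv_one, norm_iteratedFDeriv_fderiv,
            norm_iteratedFDeriv_iteratedFDeriv, add_comm]
          exact h₂' z (hball hz) (l + 2) le_rfl)
      rw [norm_fderiv_iteratedFDeriv] at key
      refine key.trans ?_
      rw [add_mul]
      refine (le_of_eq ?_).trans (le_add_of_nonneg_left (by positivity))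
      simp only [pow_add]
      field_simp

theorem IsNegligible.rapidlySmall {u : Net 𝕜 Ω} (hu : IsNegligible u) {K : Set E}
    (hK : IsCompact K) (hKΩ : K ⊆ Ω) : RapidlySmall (fun ε x => zeroExt (u ε : Ω → 𝕜) x) K := by
  intro N
  obtain ⟨C, η, hC, hη, h⟩ := hu K hK hKΩ 0 N
  refine ⟨C, η, hC, hη, fun ε hε x hx => ?_⟩
  have hε0 : (0 : ℝ) < ε := ε.2.1
  have := (semi_le_iff (by positivity)).1 (h ε hε) x hx 0 le_rfl
  rwa [norm_iteratedFDeriv_zero] at this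

theorem cl_eq_cl_iff {u v : Moderate 𝕜 Ω} : cl u = cl v ↔ IsNegligible (u.1 - v.1) :=
  Ideal.Quotient.eq

theorem cl_eq_zero_iff {u : Moderate 𝕜 Ω} : cl u = 0 ↔ IsNegligible u.1 :=
  Ideal.Quotient.eq_zero_iff_mem

theorem exists_cl_eq (g : GenFun 𝕜 Ω) : ∃ u : Moderate 𝕜 Ω, cl u = g :=
  Ideal.Quotient.mk_surjective g

theorem zeroExt_sub (f g : SmoothFun 𝕜 Ω) (x : E) :
    zeroExt ((f - g : SmoothFun 𝕜 Ω) : Ω → 𝕜) x =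
      zeroExt (f : Ω → 𝕜) x - zeroExt (g : Ω → 𝕜) x := by
  by_cases hx : x ∈ Ω <;> simp [zeroExt, hx]

/-- Two moderate nets define the same generalized function if their difference is rapidly small on
compact sets. -/
theorem cl_eq_cl_of_rapidlySmall [ProperSpace E] {u v : Moderate 𝕜 Ω}
    (h : ∀ K : Set E, IsCompact K → K ⊆ Ω →
      RapidlySmall (fun ε x => zeroExt (u.1 ε : Ω → 𝕜) x - zeroExt (v.1 ε : Ω → 𝕜) x) K) :
    cl u = cl v := by
  refine cl_eq_cl_iff.2 (isNegligible_of_rapidlySmall (u - v).2 fun K hK hKΩ => ?_)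
  simpa only [Pi.sub_apply, zeroExt_sub] using h K hK hKΩ

theorem restrict_cl {V : Opens E} (hV : V ≤ Ω) (u : Moderate 𝕜 Ω) :
    GenFun.restrict hV (cl u) =
      cl (Moderate.pull (ContinuousLinearMap.id ℝ E) (fun _ hx => hV hx) u) := rfl

theorem zeroExt_pull_id {V : Opens E} (hV : V ≤ Ω) (f : SmoothFun 𝕜 Ω) {x : E} (hx : x ∈ V) :
    zeroExt (SmoothFun.pull (ContinuousLinearMap.id ℝ E) (fun _ hx => hV hx) f : V → 𝕜) x =
      zeroExt (f : Ω → 𝕜) x := by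
  rw [zeroExt_apply _ hx, zeroExt_apply _ (hV hx)]
  rfl

/-- A representative of `g` is rapidly small on compact sets that do not meet the support of `g`. -/
theorem rapidlySmall_of_disjoint_supp [ProperSpace E] (u : Moderate 𝕜 Ω) {K : Set E} (hK : IsCompact K)
    (hKΩ : K ⊆ Ω) (hd : ∀ x ∈ K, x ∉ (cl u).supp) :
    RapidlySmall (fun ε x => zeroExt (u.1 ε : Ω → 𝕜) x) K := by
  refine hK.induction_on .empty (fun s t hst ht => ht.mono hst) (fun s t hs ht => hs.union ht) ?_
  intro x hx
  obtain ⟨V, hV, hxV, h⟩ : ∃ (V : Opens E) (hV : V ≤ Ω), x ∈ V ∧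
      GenFun.restrict hV (cl u) = 0 := by
    by_contra! hcon
    exact hd x hx ⟨hKΩ hx, hcon⟩
  obtain ⟨r, hr, hrV⟩ := Metric.nhds_basis_closedBall.mem_iff.1 (V.isOpen.mem_nhds hxV)
  refine ⟨_, mem_nhdsWithin_of_mem_nhds (Metric.closedBall_mem_nhds x hr), ?_⟩
  exact ((cl_eq_zero_iff.1 ((restrict_cl hV u).symm.trans h)).rapidlySmall
    (isCompact_closedBall x r) hrV).congr fun ε z hz => zeroExt_pull_id hV (u.1 ε) (hrV hz)

theorem exists_relCompact_superset [ProperSpace E] {K : Set E} (hK : IsCompact K) (hKΩ : K ⊆ Ω) :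
    ∃ V : Opens E, RelCompact V Ω ∧ K ⊆ V := by
  obtain ⟨V, hV, hKV, hVΩ, hVc⟩ := exists_open_between_and_isCompact_closure hK Ω.isOpen hKΩ
  exact ⟨⟨V, hV⟩, ⟨hVc, hVΩ⟩, hKV⟩

/-- Generalized functions are determined by their restrictions to relatively compact open sets. -/
theorem eq_of_restrict_eq [ProperSpace E] {G G' : GenFun 𝕜 Ω}
    (h : ∀ (V : Opens E) (hV : RelCompact V Ω),
      GenFun.restrict hV.le G = GenFun.restrict hV.le G') : G = G' := by
  obtain ⟨u, rfl⟩ := exists_cl_eq G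
  obtain ⟨v, rfl⟩ := exists_cl_eq G'
  refine cl_eq_cl_of_rapidlySmall fun K hK hKΩ => ?_
  obtain ⟨V, hV, hKV⟩ := exists_relCompact_superset hK hKΩ
  refine ((cl_eq_cl_iff.1 (h V hV)).rapidlySmall hK hKV).congr fun ε x hx => ?_
  rw [← zeroExt_pull_id hV.le (u.1 ε) (hKV hx), ← zeroExt_pull_id hV.le (v.1 ε) (hKV hx),
    ← zeroExt_sub]
  rfl

end ZerothOrder

/-- The integrals over `A ∩ B` cancel, leaving only the two differences, where `f` is small. -/
theorem norm_setIntegral_sub_setIntegral_le {α G : Type*} [MeasurableSpace α] {μ : Measure α}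
    [NormedAddCommGroup G] [NormedSpace ℝ G] {A B : Set α} (hA : MeasurableSet A)
    (hB : MeasurableSet B) (hμA : μ A ≠ ⊤) (hμB : μ B ≠ ⊤) {f : α → G} (hfA : IntegrableOn f A μ)
    (hfB : IntegrableOn f B μ) {M : ℝ} (hM : 0 ≤ M) (hAB : ∀ x ∈ A \ B, ‖f x‖ ≤ M)
    (hBA : ∀ x ∈ B \ A, ‖f x‖ ≤ M) :
    ‖∫ x in A, f x ∂μ - ∫ x in B, f x ∂μ‖ ≤ (μ.real A + μ.real B) * M := by
  have key : ∀ {A B : Set α}, μ A ≠ ⊤ → (∀ x ∈ A \ B, ‖f x‖ ≤ M) →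
      ‖∫ x in A \ B, f x ∂μ‖ ≤ μ.real A * M := fun {A B} hμ h => by
    have hlt : μ (A \ B) < ⊤ := (measure_mono sdiff_subset).trans_lt hμ.lt_top
    refine (norm_setIntegral_le_of_norm_le_const hlt h).trans ?_
    rw [mul_comm]
    gcongr
    exact sdiff_subset
  rw [← integral_inter_add_sdiff hB hfA, ← integral_inter_add_sdiff hA hfB, inter_comm B A,
    add_sub_add_left_eq_sub, add_mul]
  exact (norm_sub_le _ _).trans (add_le_add (key hμA hAB) (key hμB hBA))

/-! ### Existence and uniqueness of the generalized integral operator. -/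

section IntegralOperator

variable {m n : ℕ} {𝕜 : Type*} [RCLike 𝕜]
  {X : Opens (EuclideanSpace ℝ (Fin m))} {Y : Opens (EuclideanSpace ℝ (Fin n))}

/-- If `f` vanished on a neighbourhood `V` of `p.2`, the product would vanish on `X × V`. Thus one
`W` containing the support of `f` serves all `x`. -/
theorem snd_mem_supp_of_mem_supp_mul_pullSnd {H : GenFun 𝕜 (prodOpens X Y)} {f : GenFun 𝕜 Y}
    {p : EuclideanSpace ℝ (Fin m) × EuclideanSpace ℝ (Fin n)}
    (hp : p ∈ (H * pullSnd X f).supp) : p.2 ∈ f.supp := by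
  refine ⟨hp.1.2, fun V hV hpV h0 => ?_⟩
  have hV' : prodOpens X V ≤ prodOpens X Y := fun q hq => ⟨hq.1, hV hq.2⟩
  refine hp.2 _ hV' ⟨hp.1.1, hpV⟩ ?_
  have hcomm : GenFun.restrict hV' (pullSnd X f) = pullSnd X (GenFun.restrict hV f) := by
    obtain ⟨u, rfl⟩ := exists_cl_eq f
    rfl
  rw [map_mul, hcomm, h0]
  simp [pullSnd]

/-- The distribution `f ↦ ∫_W f` for a relatively compact open subset `W` of `Y`. -/
noncomputable def RelCompact.integral {W : Opens (EuclideanSpace ℝ (Fin n))}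
    (hW : RelCompact W Y) : CompactDistribution 𝕜 Y :=
  integralDistribution (W : Set (EuclideanSpace ℝ (Fin n))) hW.1 hW.2

theorem zeroExt_kernelSlice (h : SmoothFun 𝕜 (prodOpens X Y)) (x : X)
    (y : EuclideanSpace ℝ (Fin n)) :
    zeroExt (kernelSlice h x : Y → 𝕜) y =
      zeroExt (h : prodOpens X Y → 𝕜) ((x : EuclideanSpace ℝ (Fin m)), y) := by
  by_cases hy : y ∈ Y
  · rw [zeroExt_apply _ hy, kernelSlice_apply]
  · have : ((x : EuclideanSpace ℝ (Fin m)), y) ∉ prodOpens X Y := fun h => hy h.2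
    simp [zeroExt, hy, this]

theorem zeroExt_pairing_integral {W : Opens (EuclideanSpace ℝ (Fin n))} (hW : RelCompact W Y)
    (h : SmoothFun 𝕜 (prodOpens X Y)) {x : EuclideanSpace ℝ (Fin m)} (hx : x ∈ X) :
    zeroExt (hW.integral.pairing h : X → 𝕜) x =
      ∫ y in (W : Set (EuclideanSpace ℝ (Fin n))), zeroExt (h : prodOpens X Y → 𝕜) (x, y) := by
  rw [zeroExt_apply _ hx, CompactDistribution.pairing_apply]
  simp only [RelCompact.integral, integralDistribution_apply, zeroExt_kernelSlice]

theorem integrableOn_slice {W : Opens (EuclideanSpace ℝ (Fin n))} (hW : RelCompact W Y)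
    (h : SmoothFun 𝕜 (prodOpens X Y)) {x : EuclideanSpace ℝ (Fin m)} (hx : x ∈ X) :
    IntegrableOn (fun y => zeroExt (h : prodOpens X Y → 𝕜) (x, y))
      (W : Set (EuclideanSpace ℝ (Fin n))) := by
  refine integrableOn_of_continuousOn hW.1 ?_
  exact (SmoothFun.smoothOn h).continuousOn.comp (by fun_prop) fun y hy => ⟨hx, hW.2 hy⟩

theorem RelCompact.volume_ne_top {W : Opens (EuclideanSpace ℝ (Fin n))} (hW : RelCompact W Y) :
    volume (W : Set (EuclideanSpace ℝ (Fin n))) ≠ ⊤ :=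
  ((measure_mono subset_closure).trans_lt hW.1.measure_lt_top).ne

/-- For integration over `W`, this is the independence of the representative demanded by
`IsParamIntegral`. -/
theorem cl_pairingNet_congr (T : CompactDistribution 𝕜 Y) {u v : Moderate 𝕜 (prodOpens X Y)}
    (h : cl u = cl v) : cl (T.pairingNet u) = cl (T.pairingNet v) := by
  rw [cl_eq_cl_iff] at h ⊢
  have : ((T.pairingNet u).1 - (T.pairingNet v).1) = fun ε => T.pairing ((u.1 - v.1) ε) := by
    funext ε
    exact (T.pairing_sub _ _).symm
  rw [this]
  exact T.isNegligible_pairing h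

/-- The generalized parameter integral does not depend on the domain of integration, as long as it
contains the support in the second variable. -/
theorem restrict_cl_pairingNet_integral_eq {V : Opens (EuclideanSpace ℝ (Fin m))} (hV : V ≤ X)
    {W W' : Opens (EuclideanSpace ℝ (Fin n))} (hW : RelCompact W Y) (hW' : RelCompact W' Y)
    (u : Moderate 𝕜 (prodOpens X Y))
    (hs : ∀ p ∈ (cl u).supp, p.1 ∈ V → p.2 ∈ W) (hs' : ∀ p ∈ (cl u).supp, p.1 ∈ V → p.2 ∈ W') :
    GenFun.restrict hV (cl (hW.integral.pairingNet u)) =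
      GenFun.restrict hV (cl (hW'.integral.pairingNet u)) := by
  rw [restrict_cl, restrict_cl]
  refine cl_eq_cl_of_rapidlySmall fun K hK hKV => ?_
  have hKX : K ⊆ X := fun x hx => hV (hKV hx)
  -- `K × (closure W \ W')` is compact and misses the support, so the representative is uniformly
  -- rapidly small on it.
  have hsmall : ∀ {W W' : Opens (EuclideanSpace ℝ (Fin n))}, RelCompact W Y →
      (∀ p ∈ (cl u).supp, p.1 ∈ V → p.2 ∈ W') → RapidlySmall
        (fun ε p => zeroExt (u.1 ε : prodOpens X Y → 𝕜) p)
        (K ×ˢ (closure (W : Set (EuclideanSpace ℝ (Fin n))) \ W')) := by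
    intro W W' hW hs
    refine rapidlySmall_of_disjoint_supp u (hK.prod (hW.1.diff W'.isOpen))
      (prod_mono hKX (sdiff_subset.trans hW.2)) fun p hp hps => ?_
    exact hp.2.2 (hs p hps (hKV hp.1))
  refine ((hsmall hW hs').union (hsmall hW' hs)).of_le (S' := K)
    (volume.real (W : Set (EuclideanSpace ℝ (Fin n))) +
      volume.real (W' : Set (EuclideanSpace ℝ (Fin n)))) 0 (by positivity) ?_
  intro ε B hB hu x hx
  have hxV : x ∈ V := hKV hx
  have h1 : ∀ {W : Opens (EuclideanSpace ℝ (Fin n))} (hW : RelCompact W Y),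
      zeroExt (SmoothFun.pull (ContinuousLinearMap.id ℝ _) (fun _ hx => hV hx)
        (hW.integral.pairing (u.1 ε)) : V → 𝕜) x =
        ∫ y in (W : Set (EuclideanSpace ℝ (Fin n))),
          zeroExt (u.1 ε : prodOpens X Y → 𝕜) (x, y) := fun hW => by
    rw [zeroExt_pull_id hV _ hxV, zeroExt_pairing_integral hW _ (hV hxV)]
  change ‖zeroExt (SmoothFun.pull (ContinuousLinearMap.id ℝ _) (fun _ hx => hV hx)
        (hW.integral.pairing (u.1 ε)) : V → 𝕜) x - zeroExt (SmoothFun.pull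
        (ContinuousLinearMap.id ℝ _) (fun _ hx => hV hx)
        (hW'.integral.pairing (u.1 ε)) : V → 𝕜) x‖ ≤ _
  rw [h1 hW, h1 hW', pow_zero, inv_one, mul_one]
  exact norm_setIntegral_sub_setIntegral_le W.isOpen.measurableSet W'.isOpen.measurableSet
    hW.volume_ne_top hW'.volume_ne_top (integrableOn_slice hW _ (hV hxV))
    (integrableOn_slice hW' _ (hV hxV)) hB
    (fun y hy => hu (x, y) (.inl ⟨hx, subset_closure hy.1, hy.2⟩))
    (fun y hy => hu (x, y) (.inr ⟨hx, subset_closure hy.1, hy.2⟩))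

/-- The parameter integral of a generalized function whose support is relatively compact in the
second variable. -/
theorem isParamIntegral_iff {W : Opens (EuclideanSpace ℝ (Fin n))} (hW : RelCompact W Y)
    (u : Moderate 𝕜 (prodOpens X Y)) (hs : ∀ p ∈ (cl u).supp, p.2 ∈ W) (G : GenFun 𝕜 X) :
    IsParamIntegral (cl u) G ↔ G = cl (hW.integral.pairingNet u) := by
  constructor
  · intro h
    refine eq_of_restrict_eq fun V hV => ?_
    obtain ⟨v, hv, hG⟩ := h V hV W hW (fun p hp => ⟨hp.2.1, hs p hp.1⟩) u rfl
    rw [hG, restrict_cl]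
    congr 1
    refine Subtype.ext (funext fun ε => Subtype.ext (funext fun x => ?_))
    rw [hv ε x, ← zeroExt_pairing_integral hW _ (hV.le x.2), zeroExt_apply _ (hV.le x.2)]
    rfl
  · rintro rfl V hV W' hW' hsupp u' hu'
    refine ⟨Moderate.pull (ContinuousLinearMap.id ℝ _) (fun _ hx => hV.le hx)
      (hW'.integral.pairingNet u'), fun ε x => ?_, ?_⟩
    · rw [← zeroExt_pairing_integral hW' _ (hV.le x.2), zeroExt_apply _ (hV.le x.2)]
      rfl
    -- The representative is changed to `u'`, then the domain of integration from `W` to `W'`.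
    · rw [← restrict_cl hV.le, cl_pairingNet_congr _ hu'.symm]
      refine restrict_cl_pairingNet_integral_eq hV.le hW hW' u' (fun p hp _ => hs p ?_)
        fun p hp hpV => ?_
      · rwa [hu'] at hp
      · rw [hu'] at hp
        exact (hsupp ⟨hp, hpV, hp.1.2⟩).2

/-- The generalized integral operator with kernel `H` exists. -/
theorem exists_isGenIntegralOperator (H : GenFun 𝕜 (prodOpens X Y)) :
    ∃ B : CompactGenFun 𝕜 Y → GenFun 𝕜 X, IsGenIntegralOperator H B := by
  have : ∀ f : CompactGenFun 𝕜 Y, ∃ G₀ : GenFun 𝕜 X,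
      ∀ G : GenFun 𝕜 X, IsParamIntegral (H * pullSnd X f.1) G ↔ G = G₀ := by
    intro f
    obtain ⟨W, hW, hfW⟩ := exists_relCompact_superset f.2 (fun x hx => hx.1)
    obtain ⟨u, hu⟩ := exists_cl_eq (H * pullSnd X f.1)
    refine ⟨_, fun G => hu ▸ isParamIntegral_iff hW u (fun p hp => ?_) G⟩
    rw [hu] at hp
    exact hfW (snd_mem_supp_of_mem_supp_mul_pullSnd hp)
  choose B hB using this
  exact ⟨B, hB⟩

end IntegralOperator

/-! ### Estimates for the mollifier kernel `ρ_ε(x - y)`. -/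

section Mollification

variable {n : ℕ} {𝕜 : Type*} [RCLike 𝕜] {X Y : Opens (EuclideanSpace ℝ (Fin n))}

/-- Read off from moderateness of the constant net at the single parameter `min η 1`. -/
theorem exists_semi_le {E : Type*} [NormedAddCommGroup E] [NormedSpace ℝ E] {Ω : Opens E}
    {K : Set E} (hK : IsCompact K) (hKΩ : K ⊆ Ω) (l : ℕ) (f : SmoothFun 𝕜 Ω) :
    ∃ B : ℝ, 0 ≤ B ∧ semi K l f ≤ ENNReal.ofReal B := by
  obtain ⟨N, C, η, hC, hη, h⟩ := isModerate_const f K hK hKΩ l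
  have hε : 0 < min η 1 := lt_min hη one_pos
  exact ⟨_, by positivity, h ⟨min η 1, hε, min_le_right _ _⟩ (min_le_left _ _)⟩

/-- The scaled mollifier `z ↦ ε^{-n} ρ(z / ε)`. -/
noncomputable def scaledMollifier (ρ : 𝓢(EuclideanSpace ℝ (Fin n), 𝕜)) (ε : ℝ)
    (z : EuclideanSpace ℝ (Fin n)) : 𝕜 :=
  (ε ^ n)⁻¹ • ρ (ε⁻¹ • z)

theorem contDiff_scaledMollifier (ρ : 𝓢(EuclideanSpace ℝ (Fin n), 𝕜)) (ε : ℝ) :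
    ContDiff ℝ ∞ (scaledMollifier ρ ε) := by
  have h1 : ContDiff ℝ ∞ ρ := ρ.smooth ⊤
  unfold scaledMollifier
  fun_prop

/-- The normalization costs `ε^{-n}` and each derivative one more factor `ε^{-1}`. -/
theorem norm_iteratedFDeriv_scaledMollifier_le (ρ : 𝓢(EuclideanSpace ℝ (Fin n), 𝕜)) {ε : ℝ}
    (hε : 0 < ε) (k : ℕ) (z : EuclideanSpace ℝ (Fin n)) :
    ‖iteratedFDeriv ℝ k (scaledMollifier ρ ε) z‖ ≤
      (ε ^ (n + k))⁻¹ * ‖iteratedFDeriv ℝ k ρ (ε⁻¹ • z)‖ := by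
  have h1 : ContDiff ℝ ∞ ρ := ρ.smooth ⊤
  have h2 := norm_iteratedFDeriv_comp_affine_le isOpen_univ h1.contDiffOn
    (ε⁻¹ • ContinuousLinearMap.id ℝ (EuclideanSpace ℝ (Fin n))) 0 (x := z) (mem_univ _) k
  have h3 : ContDiffAt ℝ k (fun z => ρ ((ε⁻¹ • ContinuousLinearMap.id ℝ _) z + 0)) z := by
    have : ContDiff ℝ k ρ := ρ.smooth k
    exact ContDiff.contDiffAt (by fun_prop)
  have h4 : scaledMollifier ρ ε =
      (ε ^ n)⁻¹ • fun z => ρ ((ε⁻¹ • ContinuousLinearMap.id ℝ _) z + 0) := by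
    funext z
    simp [scaledMollifier]
  rw [h4, iteratedFDeriv_const_smul_apply h3, norm_smul, Real.norm_of_nonneg (by positivity),
    pow_add, mul_inv, mul_assoc]
  gcongr
  refine h2.trans ?_
  have h5 : ‖ε⁻¹ • ContinuousLinearMap.id ℝ (EuclideanSpace ℝ (Fin n))‖ ≤ ε⁻¹ := by
    rw [norm_smul, Real.norm_of_nonneg (by positivity)]
    exact mul_le_of_le_one_right (by positivity) ContinuousLinearMap.norm_id_le
  have h6 : (ε⁻¹ • ContinuousLinearMap.id ℝ (EuclideanSpace ℝ (Fin n))) z + 0 = ε⁻¹ • z := by simp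
  rw [h6, ← inv_pow]
  gcongr

/-- The smooth kernel `(x, y) ↦ ρ_ε(x - y)`. -/
noncomputable def mollifierKernel (X Y : Opens (EuclideanSpace ℝ (Fin n)))
    (ρ : 𝓢(EuclideanSpace ℝ (Fin n), 𝕜)) (ε : Ioc (0 : ℝ) 1) : SmoothFun 𝕜 (prodOpens X Y) :=
  SmoothFun.ofContDiffOn _ (fun p => scaledMollifier ρ ε (p.1 - p.2))
    ((contDiff_scaledMollifier ρ ε).comp (by fun_prop)).contDiffOn

theorem kernelSlice_mollifierKernel (ρ : 𝓢(EuclideanSpace ℝ (Fin n), 𝕜)) (ε : Ioc (0 : ℝ) 1)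
    (x : X) : kernelSlice (mollifierKernel X Y ρ ε) x = mollifierAt Y ρ ε x := by
  refine Subtype.ext (funext fun y => ?_)
  have hy : ((x : EuclideanSpace ℝ (Fin n)), (y : EuclideanSpace ℝ (Fin n))) ∈ prodOpens X Y :=
    ⟨x.2, y.2⟩
  rw [kernelSlice_apply, zeroExt_apply _ hy]
  rfl

/-- Only boundedness of the derivatives of `ρ` is used, so the bound of order `ε^{-(n+l)}` is
uniform in `K`. -/
theorem isModerate_mollifierKernel (X Y : Opens (EuclideanSpace ℝ (Fin n)))
    (ρ : 𝓢(EuclideanSpace ℝ (Fin n), 𝕜)) : IsModerate (mollifierKernel X Y ρ) := by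
  intro K hK hKΩ l
  choose C hC hρ using fun k => ρ.decay 0 k
  let L : EuclideanSpace ℝ (Fin n) × EuclideanSpace ℝ (Fin n) →L[ℝ] EuclideanSpace ℝ (Fin n) :=
    ContinuousLinearMap.fst ℝ _ _ - ContinuousLinearMap.snd ℝ _ _
  refine ⟨n + l, ∑ k ∈ Finset.range (l + 1), ‖L‖ ^ k * C k, 1,
    Finset.sum_nonneg fun k _ => mul_nonneg (by positivity) (hC k).le, one_pos, fun ε _ => ?_⟩
  have hε0 : (0 : ℝ) < ε := ε.2.1
  have hC0 : ∀ k, 0 ≤ ‖L‖ ^ k * C k := fun k => mul_nonneg (by positivity) (hC k).le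
  rw [semi_le_iff (mul_nonneg (Finset.sum_nonneg fun k _ => hC0 k) (by positivity))]
  intro p hp k hk
  have e : zeroExt (mollifierKernel X Y ρ ε : prodOpens X Y → 𝕜) =ᶠ[nhds p]
      fun p => scaledMollifier ρ ε (L p + 0) :=
    zeroExt_eventuallyEq (fun q => by simp [L]; rfl) (hKΩ hp)
  rw [(e.iteratedFDeriv ℝ k).eq_of_nhds]
  refine (norm_iteratedFDeriv_comp_affine_le isOpen_univ
    (contDiff_scaledMollifier ρ ε).contDiffOn L 0 (mem_univ _) k).trans ?_
  have h1 := norm_iteratedFDeriv_scaledMollifier_le ρ hε0 k (L p + 0)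
  have h2 := hρ k ((ε : ℝ)⁻¹ • (L p + 0))
  rw [pow_zero, one_mul] at h2
  have h3 : ((ε : ℝ) ^ (n + k))⁻¹ ≤ ((ε : ℝ) ^ (n + l))⁻¹ :=
    inv_anti₀ (by positivity) (pow_le_pow_of_le_one hε0.le ε.2.2 (by omega))
  calc _ ≤ ‖L‖ ^ k * (((ε : ℝ) ^ (n + l))⁻¹ * C k) := by
        gcongr
        exact h1.trans (mul_le_mul h3 h2 (norm_nonneg _) (by positivity))
    _ = (‖L‖ ^ k * C k) * ((ε : ℝ) ^ (n + l))⁻¹ := by ring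
    _ ≤ _ := by
        gcongr
        exact Finset.single_le_sum (f := fun k => ‖L‖ ^ k * C k) (fun i _ => hC0 i)
          (Finset.mem_range.2 (Nat.lt_succ_iff.2 hk))

/-- The moderate net of kernels `(x, y) ↦ ρ_ε(x - y)`. -/
noncomputable def mollifierNet (X Y : Opens (EuclideanSpace ℝ (Fin n)))
    (ρ : 𝓢(EuclideanSpace ℝ (Fin n), 𝕜)) : Moderate 𝕜 (prodOpens X Y) :=
  ⟨mollifierKernel X Y ρ, isModerate_mollifierKernel X Y ρ⟩

/-- Away from the diagonal, `ρ_ε(x - y)` and its derivatives in `y` are rapidly small. -/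
theorem exists_norm_iteratedFDeriv_mollifierAt_le (ρ : 𝓢(EuclideanSpace ℝ (Fin n), 𝕜)) {δ : ℝ}
    (hδ : 0 < δ) (l N : ℕ) : ∃ C : ℝ, 0 ≤ C ∧ ∀ (ε : Ioc (0 : ℝ) 1)
      (x y : EuclideanSpace ℝ (Fin n)), y ∈ Y → δ ≤ ‖x - y‖ → ∀ k ≤ l,
      ‖iteratedFDeriv ℝ k (zeroExt (mollifierAt Y ρ ε x : Y → 𝕜)) y‖ ≤ C * (ε : ℝ) ^ N := by
  -- At distance at least `δ` from the diagonal the argument of `ρ` has norm at least `δ / ε`. Decay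
  -- of order `n + l + N` pays for the loss `ε^{-(n+k)}`, `k ≤ l`, and leaves `ε^N`.
  choose C hC hρ using fun k => ρ.decay (n + l + N) k
  have hC0 : ∀ k, 0 ≤ C k / δ ^ (n + l + N) := fun k => div_nonneg (hC k).le (by positivity)
  refine ⟨∑ k ∈ Finset.range (l + 1), C k / δ ^ (n + l + N), Finset.sum_nonneg fun k _ => hC0 k,
    fun ε x y hy hxy k hk => ?_⟩
  have hε0 : (0 : ℝ) < ε := ε.2.1
  have e : zeroExt (mollifierAt Y ρ ε x : Y → 𝕜) =ᶠ[nhds y]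
      fun y => scaledMollifier ρ ε ((-ContinuousLinearMap.id ℝ _) y + x) :=
    zeroExt_eventuallyEq (fun q => by simp [neg_add_eq_sub]; rfl) hy
  rw [(e.iteratedFDeriv ℝ k).eq_of_nhds]
  refine (norm_iteratedFDeriv_comp_affine_le isOpen_univ
    (contDiff_scaledMollifier ρ ε).contDiffOn _ x (mem_univ _) k).trans ?_
  refine (mul_le_of_le_one_left (norm_nonneg _) (pow_le_one₀ (norm_nonneg _)
    ((norm_neg _).trans_le ContinuousLinearMap.norm_id_le))).trans ?_
  have hz : (-ContinuousLinearMap.id ℝ (EuclideanSpace ℝ (Fin n))) y + x = x - y := by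
    simp [neg_add_eq_sub]
  rw [hz]
  refine (norm_iteratedFDeriv_scaledMollifier_le ρ hε0 k (x - y)).trans ?_
  set D := ‖iteratedFDeriv ℝ k ρ ((ε : ℝ)⁻¹ • (x - y))‖
  have h1 : (δ / ε) ^ (n + l + N) * D ≤ C k := by
    refine le_trans ?_ (hρ k ((ε : ℝ)⁻¹ • (x - y)))
    rw [norm_smul, norm_inv, Real.norm_of_nonneg hε0.le, div_eq_inv_mul]
    gcongr
  have h2 : D ≤ C k / δ ^ (n + l + N) * (ε : ℝ) ^ (n + l + N) := by
    rw [div_pow] at h1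
    rw [div_mul_eq_mul_div, le_div_iff₀ (by positivity)]
    rw [div_mul_eq_mul_div, div_le_iff₀ (by positivity)] at h1
    linarith
  have h3 : ((ε : ℝ) ^ (n + k))⁻¹ * (ε : ℝ) ^ (n + l + N) ≤ (ε : ℝ) ^ N := by
    rw [inv_mul_le_iff₀ (by positivity), ← pow_add]
    exact pow_le_pow_of_le_one hε0.le ε.2.2 (by omega)
  calc _ ≤ ((ε : ℝ) ^ (n + k))⁻¹ * (C k / δ ^ (n + l + N) * (ε : ℝ) ^ (n + l + N)) := by gcongr
    _ = C k / δ ^ (n + l + N) * (((ε : ℝ) ^ (n + k))⁻¹ * (ε : ℝ) ^ (n + l + N)) := by ring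
    _ ≤ C k / δ ^ (n + l + N) * (ε : ℝ) ^ N := mul_le_mul_of_nonneg_left h3 (hC0 k)
    _ ≤ _ := by
        gcongr
        exact Finset.single_le_sum (f := fun k => C k / δ ^ (n + l + N)) (fun i _ => hC0 i)
          (Finset.mem_range.2 (Nat.lt_succ_iff.2 hk))

/-- If `aT` vanishes on the open set `V`, then its regularizations are rapidly small on compact
subsets of `V`. -/
theorem rapidlySmall_apply_mul_mollifierAt (ρ : 𝓢(EuclideanSpace ℝ (Fin n), 𝕜))
    {T : SmoothFun 𝕜 Y →ₗ[𝕜] 𝕜} {K : Set (EuclideanSpace ℝ (Fin n))} (hKc : IsCompact K)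
    (hKY : K ⊆ Y) {l : ℕ} {C : NNReal} (hT : ∀ f, ‖T f‖ₑ ≤ C * semi K l f) (a : SmoothFun 𝕜 Y)
    {V L : Set (EuclideanSpace ℝ (Fin n))} (hV : IsOpen V) (hL : IsCompact L) (hLV : L ⊆ V)
    (ha : ∀ y ∈ K, y ∈ V → zeroExt (a : Y → 𝕜) =ᶠ[nhds y] fun _ => 0) :
    RapidlySmall (fun ε x => T (a * mollifierAt Y ρ ε x)) L := by
  obtain ⟨δ, hδ, hδV⟩ := hL.exists_thickening_subset_open hV hLV
  obtain ⟨A, hA, haA⟩ := exists_semi_le hKc hKY l a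
  intro N
  obtain ⟨D, hD, hρ⟩ := exists_norm_iteratedFDeriv_mollifierAt_le (Y := Y) ρ hδ l N
  refine ⟨C * (2 ^ l * (A * D)), 1, by positivity, one_pos, fun ε _ x hx => ?_⟩
  have hε0 : (0 : ℝ) < ε := ε.2.1
  have hB : 0 ≤ 2 ^ l * (A * (D * (ε : ℝ) ^ N)) := by positivity
  -- Points of `K \ V` stay at distance at least `δ` from `L`, so off-diagonal decay applies; on `K
  -- ∩ V` the jets of the product vanish with `a`.
  have h1 : semi (K \ V) l (a * mollifierAt Y ρ ε x) ≤
      ENNReal.ofReal (2 ^ l * (A * (D * (ε : ℝ) ^ N))) := by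
    refine semi_mul_le (sdiff_subset.trans hKY) l _ _ hA (by positivity) ?_ ?_
    · rw [semi_le_iff hA] at haA ⊢
      exact fun y hy => haA y hy.1
    · rw [semi_le_iff (by positivity)]
      intro y hy k hk
      refine hρ ε x y (hKY hy.1) ?_ k hk
      by_contra! h
      refine hy.2 (hδV (Metric.mem_thickening_iff.2 ⟨x, hx, ?_⟩))
      rwa [dist_comm, dist_eq_norm]
  refine (norm_apply_le_of_semi_le hT hB ?_).trans (le_of_eq (by ring))
  rw [semi_le_iff hB] at h1 ⊢
  intro y hy k hk
  by_cases hyV : y ∈ V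
  · have : zeroExt ((a * mollifierAt Y ρ ε x : SmoothFun 𝕜 Y) : Y → 𝕜) =ᶠ[nhds y]
        fun _ => 0 := by
      filter_upwards [ha y hy hyV, Y.isOpen.mem_nhds (hKY hy)] with z hz hzY
      rw [zeroExt_apply _ hzY] at hz ⊢
      change (a : Y → 𝕜) _ * _ = 0
      rw [hz, zero_mul]
    rw [(this.iteratedFDeriv ℝ k).eq_of_nhds]
    simpa [iteratedFDeriv_fun_zero] using hB
  · exact h1 y ⟨hy, hyV⟩ k hk

end Mollification

/-! ### The embedding `i_S` through a global regularization without cutoff. -/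

section Embedding

variable {n : ℕ} {𝕜 : Type*} [RCLike 𝕜] {Y : Opens (EuclideanSpace ℝ (Fin n))}

/-- Smooth cutoff functions. -/
theorem exists_cutoff {K W : Set (EuclideanSpace ℝ (Fin n))} (hK : IsCompact K) (hW : IsOpen W)
    (hKW : K ⊆ W) : ∃ χ : EuclideanSpace ℝ (Fin n) → ℝ, ContDiff ℝ ∞ χ ∧
      (∀ y ∈ K, χ =ᶠ[nhds y] fun _ => 1) ∧ IsCompact (tsupport χ) ∧ tsupport χ ⊆ W := by
  obtain ⟨V, hV, hKV, hVW, hVc⟩ := exists_open_between_and_isCompact_closure hK hW hKW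
  obtain ⟨f, hf1, hf0, -⟩ := exists_contMDiffMap_one_nhds_of_subset_interior (n := ⊤)
    (modelWithCornersSelf ℝ (EuclideanSpace ℝ (Fin n))) hK.isClosed (t := V)
    (by rwa [hV.interior_eq])
  have hsupp : tsupport f ⊆ closure V := closure_mono fun x hx => by
    by_contra h
    exact hx (hf0 x h)
  exact ⟨f, f.contMDiff.contDiff, fun y hy => eventually_nhdsSet_iff_forall.1 hf1 y hy,
    hVc.of_isClosed_subset (isClosed_tsupport _) hsupp, hsupp.trans hVW⟩

/-- The element of `C^∞(Y)` defined by a real-valued smooth function. -/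
noncomputable def SmoothFun.ofReal (Y : Opens (EuclideanSpace ℝ (Fin n)))
    (χ : EuclideanSpace ℝ (Fin n) → ℝ) (hχ : ContDiff ℝ ∞ χ) : SmoothFun 𝕜 Y :=
  SmoothFun.ofContDiffOn Y (fun y => (χ y : 𝕜))
    ((RCLike.ofRealCLM (K := 𝕜)).contDiff.comp hχ).contDiffOn

theorem hasCompactSupport_ofReal {χ : EuclideanSpace ℝ (Fin n) → ℝ} (hχ : ContDiff ℝ ∞ χ)
    (hc : IsCompact (tsupport χ)) (hY : tsupport χ ⊆ Y) :
    HasCompactSupport ((SmoothFun.ofReal Y χ hχ : SmoothFun 𝕜 Y) : Y → 𝕜) := by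
  refine HasCompactSupport.intro (K := Subtype.val ⁻¹' tsupport χ) ?_ fun y hy => ?_
  · rw [Subtype.isCompact_iff]
    convert hc
    exact (Subtype.image_preimage_coe (Y : Set (EuclideanSpace ℝ (Fin n))) _).trans
      (inter_eq_self_of_subset_right hY)
  · have : χ y = 0 := image_eq_zero_of_notMem_tsupport hy
    simp [SmoothFun.ofReal, SmoothFun.ofContDiffOn, this]

/-- The global net of regularizations `x ↦ ⟨T, ρ_ε(x - ·)⟩`. -/
noncomputable def regularization (ρ : 𝓢(EuclideanSpace ℝ (Fin n), 𝕜))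
    (T : CompactDistribution 𝕜 Y) : Moderate 𝕜 Y :=
  T.pairingNet (mollifierNet Y Y ρ)

theorem zeroExt_regularization (ρ : 𝓢(EuclideanSpace ℝ (Fin n), 𝕜)) (T : CompactDistribution 𝕜 Y)
    (ε : Ioc (0 : ℝ) 1) {x : EuclideanSpace ℝ (Fin n)} (hx : x ∈ Y) :
    zeroExt ((regularization ρ T).1 ε : Y → 𝕜) x = T.1 (mollifierAt Y ρ ε x) := by
  rw [zeroExt_apply _ hx]
  exact congrArg T.1 (kernelSlice_mollifierKernel ρ ε ⟨x, hx⟩)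

/-- `ψ(y) ρ_ε(x - y)` is a product of moderate nets of kernels, and pairing with `T` preserves
moderateness. -/
theorem exists_moderate_localRegularization (ρ : 𝓢(EuclideanSpace ℝ (Fin n), 𝕜))
    (T : CompactDistribution 𝕜 Y) (V : Opens (EuclideanSpace ℝ (Fin n))) (ψ : SmoothFun 𝕜 Y) :
    ∃ v : Moderate 𝕜 V, ∀ (ε : Ioc (0 : ℝ) 1) (x : V),
      (v.1 ε : V → 𝕜) x = T.1 (ψ * mollifierAt Y ρ ε x) := by
  let Ψ : Moderate 𝕜 (prodOpens V Y) :=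
    Moderate.pull (ContinuousLinearMap.snd ℝ _ _) (fun _ hx => (mem_prod.1 hx).2)
      ⟨fun _ => ψ, isModerate_const ψ⟩
  refine ⟨T.pairingNet (Ψ * mollifierNet V Y ρ), fun ε x => ?_⟩
  change T.1 (kernelSlice _ x) = _
  congr 1
  refine Subtype.ext (funext fun y => ?_)
  have hy : ((x : EuclideanSpace ℝ (Fin n)), (y : EuclideanSpace ℝ (Fin n))) ∈ prodOpens V Y :=
    ⟨x.2, y.2⟩
  rw [kernelSlice_apply, zeroExt_apply _ hy]
  rfl

/-- The two nets differ by the regularization of `(1 - ψ)T`, and `1 - ψ` vanishes on `V`. This makes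
cutoffs dispensable. -/
theorem restrict_cl_regularization (ρ : 𝓢(EuclideanSpace ℝ (Fin n), 𝕜))
    (T : CompactDistribution 𝕜 Y) {V : Opens (EuclideanSpace ℝ (Fin n))} (hV : V ≤ Y)
    (ψ : SmoothFun 𝕜 Y) (hψ : ∀ y : Y, (y : EuclideanSpace ℝ (Fin n)) ∈ V → (ψ : Y → 𝕜) y = 1)
    (v : Moderate 𝕜 V) (hv : ∀ (ε : Ioc (0 : ℝ) 1) (x : V),
      (v.1 ε : V → 𝕜) x = T.1 (ψ * mollifierAt Y ρ ε x)) :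
    GenFun.restrict hV (cl (regularization ρ T)) = cl v := by
  obtain ⟨K, hKc, hKY, l, C, hT⟩ := T.2
  rw [restrict_cl]
  refine cl_eq_cl_of_rapidlySmall fun L hL hLV => ?_
  refine (rapidlySmall_apply_mul_mollifierAt ρ hKc hKY hT (1 - ψ) V.isOpen hL hLV
    fun y _ hyV => ?_).congr fun ε x hx => ?_
  · filter_upwards [V.isOpen.mem_nhds hyV] with z hz
    rw [zeroExt_apply _ (hV hz)]
    change 1 - (ψ : Y → 𝕜) _ = 0
    rw [hψ _ hz, sub_self]
  · have h1 := zeroExt_pull_id hV ((regularization ρ T).1 ε) (hLV hx)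
    rw [zeroExt_regularization ρ T ε (hV (hLV hx))] at h1
    have h2 := (zeroExt_apply (v.1 ε : V → 𝕜) (hLV hx)).trans (hv ε ⟨x, hLV hx⟩)
    rw [h2, sub_mul, one_mul, map_sub]
    exact congrArg (· - _) h1.symm

/-- The global net meets every local condition. Conversely, each relatively compact `V` admits a
cutoff, so the local conditions fix all restrictions of `u`. -/
theorem isEmbedded_iff (ρ : 𝓢(EuclideanSpace ℝ (Fin n), 𝕜)) (T : CompactDistribution 𝕜 Y)
    (u : GenFun 𝕜 Y) : IsEmbedded ρ T u ↔ u = cl (regularization ρ T) := by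
  constructor
  · intro h
    refine eq_of_restrict_eq fun V hV => ?_
    obtain ⟨χ, hχ, hχ1, hχc, hχY⟩ := exists_cutoff hV.1 Y.isOpen hV.2
    have hψ : ∀ y : Y, (y : EuclideanSpace ℝ (Fin n)) ∈ V →
        ((SmoothFun.ofReal Y χ hχ : SmoothFun 𝕜 Y) : Y → 𝕜) y = 1 := fun y hy => by
      have := (hχ1 y (subset_closure hy)).eq_of_nhds
      simp [SmoothFun.ofReal, SmoothFun.ofContDiffOn, this]
    obtain ⟨v, hv, huv⟩ := h V hV _ (hasCompactSupport_ofReal hχ hχc hχY) hψ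
    rw [huv, restrict_cl_regularization ρ T hV.le _ hψ v hv]
  · rintro rfl V hV ψ - hψ
    obtain ⟨v, hv⟩ := exists_moderate_localRegularization ρ T V ψ
    exact ⟨v, hv, restrict_cl_regularization ρ T hV.le ψ hψ v hv⟩

/-- The local estimate is used with `a = 1` and `V = Kᶜ`, where its vanishing hypothesis is vacuous
because `V` misses `K`. -/
theorem supp_cl_regularization_subset (ρ : 𝓢(EuclideanSpace ℝ (Fin n), 𝕜))
    (T : CompactDistribution 𝕜 Y) {K : Set (EuclideanSpace ℝ (Fin n))} (hKc : IsCompact K)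
    (hKY : K ⊆ Y) {l : ℕ} {C : NNReal} (hT : ∀ f, ‖T.1 f‖ₑ ≤ C * semi K l f) :
    (cl (regularization ρ T)).supp ⊆ K := by
  intro x hx
  by_contra hxK
  have hV : Y ⊓ ⟨Kᶜ, hKc.isClosed.isOpen_compl⟩ ≤ Y := inf_le_left
  refine hx.2 _ hV ⟨hx.1, hxK⟩ ?_
  rw [restrict_cl, cl_eq_zero_iff]
  refine isNegligible_of_rapidlySmall (Subtype.property _) fun L hL hLV => ?_
  refine (rapidlySmall_apply_mul_mollifierAt ρ hKc hKY hT 1 hKc.isClosed.isOpen_compl hL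
    (fun y hy => (hLV hy).2) fun y hy hyV => (hyV hy).elim).congr fun ε y hy => ?_
  have h1 := zeroExt_pull_id hV ((regularization ρ T).1 ε) (hLV hy)
  rw [zeroExt_regularization ρ T ε (hV (hLV hy))] at h1
  rw [one_mul]
  exact h1.symm

/-- A support is closed only relative to `Ω`. Inside a compact `K ⊆ Ω` it is `K` minus the open set
where `u` vanishes locally, hence compact. -/
theorem GenFun.isCompact_supp_of_subset {E : Type*} [NormedAddCommGroup E] [NormedSpace ℝ E]
    {Ω : Opens E} {u : GenFun 𝕜 Ω} {K : Set E} (hK : IsCompact K) (hKΩ : K ⊆ Ω)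
    (hu : u.supp ⊆ K) : IsCompact u.supp := by
  have hopen : IsOpen {x | ∃ (V : Opens E) (hV : V ≤ Ω), x ∈ V ∧ GenFun.restrict hV u = 0} := by
    rw [isOpen_iff_forall_mem_open]
    rintro x ⟨V, hV, hxV, h⟩
    exact ⟨V, fun y hy => ⟨V, hV, hy, h⟩, V.isOpen, hxV⟩
  convert hK.diff hopen using 1
  ext x
  constructor
  · exact fun hx => ⟨hu hx, fun ⟨V, hV, hxV, h⟩ => hx.2 V hV hxV h⟩
  · exact fun hx => ⟨hKΩ hx.1, fun V hV hxV h => hx.2 ⟨V, hV, hxV, h⟩⟩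

theorem isCompact_supp_regularization (ρ : 𝓢(EuclideanSpace ℝ (Fin n), 𝕜))
    (T : CompactDistribution 𝕜 Y) : IsCompact (cl (regularization ρ T)).supp := by
  obtain ⟨K, hKc, hKY, l, C, hT⟩ := T.2
  exact GenFun.isCompact_supp_of_subset hKc hKY (supp_cl_regularization_subset ρ T hKc hKY hT)

end Embedding

/-! ### Vanishing moments and Taylor expansion. -/

section Moments

variable {n : ℕ} {𝕜 : Type*} [RCLike 𝕜]

theorem integrable_multilinear_mul (ρ : 𝓢(EuclideanSpace ℝ (Fin n), 𝕜)) {j : ℕ}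
    (M : EuclideanSpace ℝ (Fin n) [×j]→L[ℝ] 𝕜) :
    Integrable fun w : EuclideanSpace ℝ (Fin n) => M (fun _ => w) * ρ w := by
  refine ((ρ.integrable_pow_mul volume j).const_mul ‖M‖).mono' ?_ (.of_forall fun w => ?_)
  · have : Continuous fun w : EuclideanSpace ℝ (Fin n) => M (fun _ => w) * ρ w :=
      (M.cont.comp (by fun_prop)).mul ρ.continuous
    exact this.aestronglyMeasurable
  · rw [norm_mul, ← mul_assoc]
    gcongr
    simpa using M.le_opNorm fun _ => w

/-- The moments of a mollifier of positive order vanish, for arbitrary homogeneous polynomials. -/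
theorem IsMollifier.integral_multilinear_mul_eq_zero {ρ : 𝓢(EuclideanSpace ℝ (Fin n), 𝕜)}
    (hρ : IsMollifier ρ) {j : ℕ} (hj : j ≠ 0) (M : EuclideanSpace ℝ (Fin n) [×j]→L[ℝ] 𝕜) :
    ∫ w : EuclideanSpace ℝ (Fin n), M (fun _ => w) * ρ w = 0 := by
  let e : Fin n → EuclideanSpace ℝ (Fin n) := fun a => EuclideanSpace.single a 1
  -- Expanding in the standard basis turns the homogeneous polynomial `M(w, …, w)` into a
  -- combination of monomials.
  have hM : ∀ w : EuclideanSpace ℝ (Fin n), M (fun _ => w) =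
      ∑ f : Fin j → Fin n, (∏ i, w (f i)) • M fun i => e (f i) := by
    intro w
    have hw : w = ∑ a, w a • e a := by
      have := (EuclideanSpace.basisFun (Fin n) ℝ).sum_repr w
      simpa [e] using this.symm
    conv_lhs => rw [hw]
    have := M.toMultilinearMap.map_sum (fun (_ : Fin j) a => w a • e a)
    refine this.trans (Finset.sum_congr rfl fun f _ => ?_)
    exact M.toMultilinearMap.map_smul_univ (fun i => w (f i)) fun i => e (f i)
  -- The multi-index of the monomial attached to `f` counts the fibres of `f`; it is nonzero below
  -- because `j ≠ 0`.
  have hprod : ∀ (f : Fin j → Fin n) (w : EuclideanSpace ℝ (Fin n)),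
      ∏ i, w (f i) = ∏ a, w a ^ (Finset.univ.filter fun i => f i = a).card := fun f w => by
    rw [← Finset.prod_fiberwise' (s := Finset.univ) (g := f) (f := fun a => w a)]
    simp
  have hterm : ∀ (f : Fin j → Fin n), Integrable fun w : EuclideanSpace ℝ (Fin n) =>
      (∏ i, w (f i)) • ρ w := fun f => by
    refine (ρ.integrable_pow_mul volume j).mono' ?_ (.of_forall fun w => ?_)
    · have : Continuous fun w : EuclideanSpace ℝ (Fin n) => (∏ i, w (f i)) • ρ w := by
        have := ρ.continuous
        fun_prop
      exact this.aestronglyMeasurable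
    · rw [norm_smul, norm_prod]
      gcongr
      calc ∏ i, ‖w (f i)‖ ≤ ∏ _i : Fin j, ‖w‖ :=
            Finset.prod_le_prod (fun _ _ => norm_nonneg _) fun i _ => PiLp.norm_apply_le w (f i)
        _ = ‖w‖ ^ j := by simp
  have hzero : ∀ f : Fin j → Fin n,
      ∫ w : EuclideanSpace ℝ (Fin n), (∏ i, w (f i)) • ρ w = 0 := fun f => by
    simp only [hprod f]
    refine hρ.2 (fun a => (Finset.univ.filter fun i => f i = a).card) fun h0 => ?_
    have := congrFun h0 (f ⟨0, Nat.pos_of_ne_zero hj⟩)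
    simp only [Pi.zero_apply, Finset.card_eq_zero] at this
    have hmem : (⟨0, Nat.pos_of_ne_zero hj⟩ : Fin j) ∈
        Finset.univ.filter fun i => f i = f ⟨0, Nat.pos_of_ne_zero hj⟩ := by simp
    rw [this] at hmem
    exact Finset.notMem_empty _ hmem
  have hsum : ∀ w : EuclideanSpace ℝ (Fin n), M (fun _ => w) * ρ w =
      ∑ f : Fin j → Fin n, (M fun i => e (f i)) * ((∏ i, w (f i)) • ρ w) := fun w => by
    rw [hM, Finset.sum_mul]
    refine Finset.sum_congr rfl fun f _ => ?_
    rw [smul_mul_assoc, mul_smul_comm]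
  simp only [hsum]
  rw [integral_finsetSum _ fun f _ => (hterm f).const_mul _]
  refine Finset.sum_eq_zero fun f _ => ?_
  rw [integral_const_mul, hzero, mul_zero]

/-- Taylor's formula at the origin for a function with a globally bounded derivative. -/
theorem norm_sub_taylor_le {E : Type*} [NormedAddCommGroup E] [NormedSpace ℝ E] {θ : E → 𝕜}
    (hθ : ContDiff ℝ ∞ θ) (N : ℕ) {B : ℝ} (hB : ∀ s, ‖iteratedFDeriv ℝ (N + 1) θ s‖ ≤ B) (s : E) :
    ‖θ s - ∑ j ∈ Finset.range (N + 1),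
      ((j.factorial : ℝ)⁻¹ • iteratedFDeriv ℝ j θ 0) (fun _ => s)‖ ≤ B * ‖s‖ ^ (N + 1) := by
  -- Reduction to the one-variable Taylor formula for `t ↦ θ(t s)` on `[0, 1]`.
  let L : ℝ →L[ℝ] E := ContinuousLinearMap.toSpanSingleton ℝ s
  have hL : ∀ t, L t = t • s := fun t => rfl
  have hcont : ContDiff ℝ ∞ (fun t => θ (L t)) := hθ.comp L.contDiff
  have hder : ∀ (k : ℕ), ∀ t ∈ Icc (0 : ℝ) 1,
      iteratedDerivWithin k (fun t => θ (L t)) (Icc 0 1) t =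
        iteratedFDeriv ℝ k θ (t • s) fun _ => s := by
    intro k t ht
    rw [iteratedDerivWithin_eq_iteratedDeriv (uniqueDiffOn_Icc one_pos)
      (hcont.of_le (by exact_mod_cast le_top)).contDiffAt ht, iteratedDeriv_eq_iteratedFDeriv]
    have := L.iteratedFDeriv_comp_right hθ t (i := k) (by exact_mod_cast le_top)
    refine (congrArg (fun M => M fun _ => 1) this).trans ?_
    simp [hL]
  have key := taylor_mean_remainder_bound (f := fun t => θ (L t)) (a := 0) (b := 1) (x := 1)
    (n := N) (C := B * ‖s‖ ^ (N + 1)) zero_le_one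
    (hcont.of_le (by exact_mod_cast le_top)).contDiffOn (by simp) fun t ht => by
      rw [hder _ t ht]
      refine (ContinuousMultilinearMap.le_of_opNorm_le (hB (t • s)) fun _ => s).trans (le_of_eq ?_)
      simp
  rw [taylor_within_apply] at key
  have hB0 : 0 ≤ B := (norm_nonneg _).trans (hB 0)
  simp only [hL, one_smul, sub_zero, one_pow, mul_one] at key
  refine le_trans (le_of_eq ?_) (key.trans ?_)
  · congr 2
    refine Finset.sum_congr rfl fun j _ => ?_
    have := hder j 0 (by simp)
    simp only [hL] at this
    rw [this, zero_smul]
    rfl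
  -- The factor `1 / N!` of the remainder is discarded.
  · refine div_le_self (by positivity) ?_
    exact_mod_cast Nat.one_le_iff_ne_zero.2 (Nat.factorial_ne_zero N)

/-- Averages against a scaled mollifier converge to the value at the origin, with an error of
arbitrarily high order. -/
theorem IsMollifier.norm_integral_mul_scaledMollifier_sub_le
    {ρ : 𝓢(EuclideanSpace ℝ (Fin n), 𝕜)} (hρ : IsMollifier ρ)
    {θ : EuclideanSpace ℝ (Fin n) → 𝕜} (hθ : ContDiff ℝ ∞ θ) (N : ℕ) {B : ℝ}
    (hB : ∀ s, ‖iteratedFDeriv ℝ (N + 1) θ s‖ ≤ B) {ε : ℝ} (hε : 0 < ε) :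
    ‖(∫ s, θ s * scaledMollifier ρ ε s) - θ 0‖ ≤
      B * (∫ w : EuclideanSpace ℝ (Fin n), ‖w‖ ^ (N + 1) * ‖ρ w‖) * ε ^ (N + 1) := by
  -- Substitution `s = ε w`.
  have hchange : ∫ s, θ s * scaledMollifier ρ ε s = ∫ w, θ (ε • w) * ρ w := by
    have := Measure.integral_comp_smul_of_nonneg (μ := volume)
      (fun s => θ s * scaledMollifier ρ ε s) ε (hR := hε.le)
    rw [finrank_euclideanSpace_fin] at this
    have h2 : ∀ w, θ (ε • w) * scaledMollifier ρ ε (ε • w) = (ε ^ n)⁻¹ • (θ (ε • w) * ρ w) :=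
      fun w => by
        rw [scaledMollifier, smul_smul, inv_mul_cancel₀ hε.ne', one_smul, mul_smul_comm]
    simp only [h2] at this
    rw [integral_smul] at this
    exact (smul_right_injective 𝕜 (inv_ne_zero (pow_ne_zero n hε.ne')) this).symm
  -- The Taylor coefficients of `w ↦ θ(ε w)`: the factor `ε ^ j` is absorbed so that `P` is a
  -- polynomial in `w`.
  let M : ∀ j : ℕ, EuclideanSpace ℝ (Fin n) [×j]→L[ℝ] 𝕜 := fun j =>
    ε ^ j • ((j.factorial : ℝ)⁻¹ • iteratedFDeriv ℝ j θ 0)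
  let P : EuclideanSpace ℝ (Fin n) → 𝕜 := fun w =>
    ∑ j ∈ Finset.range (N + 1), M j (fun _ => w)
  have hPint : Integrable fun w => P w * ρ w := by
    simp only [P, Finset.sum_mul]
    exact integrable_finsetSum _ fun j _ => integrable_multilinear_mul ρ (M j)
  -- Only the term `j = 0` survives: the higher moments vanish and `∫ ρ = 1`.
  have hP : ∫ w, P w * ρ w = θ 0 := by
    simp only [P, Finset.sum_mul]
    rw [integral_finsetSum _ fun j _ => integrable_multilinear_mul ρ (M j),
      Finset.sum_eq_single 0]
    · have : ∀ w : EuclideanSpace ℝ (Fin n), M 0 (fun _ => w) = θ 0 := fun w => by simp [M]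
      simp only [this]
      rw [integral_const_mul, hρ.1, mul_one]
    · exact fun j _ hj => hρ.integral_multilinear_mul_eq_zero hj (M j)
    · simp
  have hPw : ∀ w, P w = ∑ j ∈ Finset.range (N + 1),
      ((j.factorial : ℝ)⁻¹ • iteratedFDeriv ℝ j θ 0) (fun _ => ε • w) := fun w => by
    refine Finset.sum_congr rfl fun j _ => ?_
    have := ((j.factorial : ℝ)⁻¹ • iteratedFDeriv ℝ j θ 0).toMultilinearMap.map_smul_univ
      (fun _ => ε) fun _ => w
    refine Eq.trans ?_ this.symm
    simp [M]
  have hR : ∀ w, ‖(θ (ε • w) - P w) * ρ w‖ ≤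
      B * ε ^ (N + 1) * (‖w‖ ^ (N + 1) * ‖ρ w‖) := fun w => by
    rw [norm_mul, ← mul_assoc]
    gcongr
    rw [hPw]
    refine (norm_sub_taylor_le hθ N hB (ε • w)).trans (le_of_eq ?_)
    rw [norm_smul, Real.norm_of_nonneg hε.le, mul_pow, mul_assoc]
  have hmom := ρ.integrable_pow_mul volume (N + 1)
  have hRint : Integrable fun w => (θ (ε • w) - P w) * ρ w := by
    refine (hmom.const_mul (B * ε ^ (N + 1))).mono' ?_ (.of_forall hR)
    have hPc : Continuous P := continuous_finsetSum _ fun j _ => (M j).cont.comp (by fun_prop)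
    have : Continuous fun w => (θ (ε • w) - P w) * ρ w :=
      ((hθ.continuous.comp (by fun_prop)).sub hPc).mul ρ.continuous
    exact this.aestronglyMeasurable
  have hsplit : ∫ w, θ (ε • w) * ρ w = (∫ w, (θ (ε • w) - P w) * ρ w) + ∫ w, P w * ρ w := by
    rw [← integral_add hRint hPint]
    congr 1
    funext w
    ring
  rw [hchange, hsplit, hP, add_sub_cancel_right]
  refine (norm_integral_le_of_norm_le (hmom.const_mul (B * ε ^ (N + 1))) (.of_forall hR)).trans ?_
  rw [integral_const_mul]
  exact le_of_eq (by ring)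

end Moments

/-! ### Moving `T` outside the integral against its regularizations. -/

section Exchange

variable {n : ℕ} {𝕜 : Type*} [RCLike 𝕜] {Y : Opens (EuclideanSpace ℝ (Fin n))}

/-- Compactly supported distributions commute with integrals of smooth families of functions that
are defined everywhere. -/
theorem CompactDistribution.exists_apply_eq_integral (T : CompactDistribution 𝕜 Y)
    {S : Set (EuclideanSpace ℝ (Fin n))} (hSm : MeasurableSet S) (hS : IsCompact (closure S))
    {F : EuclideanSpace ℝ (Fin n) × EuclideanSpace ℝ (Fin n) → 𝕜} (hF : ContDiff ℝ ∞ F)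
    {s : EuclideanSpace ℝ (Fin n) → SmoothFun 𝕜 Y}
    (hs : ∀ x, ∀ y : Y, (s x : Y → 𝕜) y = F (x, y)) :
    ∃ g : SmoothFun 𝕜 Y, (∀ y : Y, (g : Y → 𝕜) y = ∫ x in S, F (x, y)) ∧
      T.1 g = ∫ x in S, T.1 (s x) := by
  -- With the variables swapped, `y` is the parameter and `∫_S` the distribution, so the integral is
  -- smooth in `y` by the pairing results.
  let k : SmoothFun 𝕜 (prodOpens Y (⊤ : Opens (EuclideanSpace ℝ (Fin n)))) :=
    SmoothFun.ofContDiffOn _ (fun p => F (p.2, p.1)) (hF.comp (by fun_prop)).contDiffOn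
  have hST : closure S ⊆ ((⊤ : Opens (EuclideanSpace ℝ (Fin n))) : Set _) := subset_univ _
  have hg : ∀ y : Y, ((integralDistribution S hS hST).pairing k : Y → 𝕜) y =
      ∫ x in S, F (x, y) := fun y => by
    rw [CompactDistribution.pairing_apply, integralDistribution_apply]
    congr 1
    funext x
    have hx : ((y : EuclideanSpace ℝ (Fin n)), x) ∈
        prodOpens Y (⊤ : Opens (EuclideanSpace ℝ (Fin n))) := ⟨y.2, mem_univ _⟩
    rw [zeroExt_kernelSlice, zeroExt_apply _ hx]
    rfl
  exact ⟨_, hg, T.apply_integral hSm hS hST hF.contDiffOn (fun x _ => hs x) hg⟩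

/-- The translate `z ↦ ψ(z + s)`. -/
noncomputable def SmoothFun.translate (Y : Opens (EuclideanSpace ℝ (Fin n)))
    {ψ : EuclideanSpace ℝ (Fin n) → 𝕜} (hψ : ContDiff ℝ ∞ ψ) (s : EuclideanSpace ℝ (Fin n)) :
    SmoothFun 𝕜 Y :=
  SmoothFun.ofContDiffOn Y (fun z => ψ (z + s)) (hψ.comp (by fun_prop)).contDiffOn

/-- `W` lies in the ball of radius `R`, so a shift by `s` of norm at least `2R` moves `W` off itself
and `ψ(· + s)` vanishes near `K`. Integrals over `s` thereby reduce to a ball. -/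
theorem apply_translate_eq_zero {T : SmoothFun 𝕜 Y →ₗ[𝕜] 𝕜}
    {K : Set (EuclideanSpace ℝ (Fin n))} (hKY : K ⊆ Y) {l : ℕ} {C : NNReal}
    (hT : ∀ f, ‖T f‖ₑ ≤ C * semi K l f) {W : Set (EuclideanSpace ℝ (Fin n))} (hW : IsOpen W)
    (hKW : K ⊆ W) {R : ℝ} (hR : ∀ w ∈ W, ‖w‖ < R) {ψ : EuclideanSpace ℝ (Fin n) → 𝕜}
    (hψ : ContDiff ℝ ∞ ψ) (hψW : ∀ y ∉ W, ψ y = 0) {s : EuclideanSpace ℝ (Fin n)}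
    (hs : 2 * R ≤ ‖s‖) : T (SmoothFun.translate Y hψ s) = 0 := by
  rw [← map_zero T]
  refine apply_eq_of_eventuallyEq hKY hT fun y hy => ?_
  filter_upwards [hW.mem_nhds (hKW hy), Y.isOpen.mem_nhds (hKY hy)] with z hz hzY
  rw [zeroExt_apply _ hzY, zeroExt_apply _ hzY]
  refine hψW (z + s) fun hzs => ?_
  have := norm_sub_le (z + s) z
  rw [add_sub_cancel_left] at this
  linarith [hR _ hz, hR _ hzs]

/-- Integration of a test function against the regularizations of `T`. -/
theorem setIntegral_mul_regularization_eq (ρ : 𝓢(EuclideanSpace ℝ (Fin n), 𝕜))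
    (T : CompactDistribution 𝕜 Y)
    {K : Set (EuclideanSpace ℝ (Fin n))} (hKY : K ⊆ Y) {l : ℕ} {C : NNReal}
    (hT : ∀ f, ‖T.1 f‖ₑ ≤ C * semi K l f) {W : Set (EuclideanSpace ℝ (Fin n))} (hW : IsOpen W)
    (hWc : IsCompact (closure W)) (hKW : K ⊆ W) {R : ℝ} (hR : ∀ w ∈ W, ‖w‖ < R)
    {ψ : EuclideanSpace ℝ (Fin n) → 𝕜} (hψ : ContDiff ℝ ∞ ψ) (hψW : ∀ y ∉ W, ψ y = 0)
    (ε : Ioc (0 : ℝ) 1) :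
    ∫ y in W, ψ y * T.1 (mollifierAt Y ρ ε y) =
      ∫ s, T.1 (SmoothFun.translate Y hψ s) * scaledMollifier ρ ε s := by
  have hρ := contDiff_scaledMollifier ρ ε
  -- Each side is written as `T` of one function: here `g(z) = ∫_W ψ(y) ρ_ε(y - z) dy`, then `g'(z)
  -- = ∫ ψ(z + s) ρ_ε(s) ds` over the ball of radius `2R`.
  obtain ⟨g, hg, hTg⟩ := T.exists_apply_eq_integral hW.measurableSet hWc
    (F := fun p => ψ p.1 * scaledMollifier ρ ε (p.1 - p.2))
    ((hψ.comp contDiff_fst).mul (hρ.comp (contDiff_fst.sub contDiff_snd)))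
    (s := fun y => ψ y • mollifierAt Y ρ ε y) fun _ _ => rfl
  obtain ⟨g', hg', hTg'⟩ := T.exists_apply_eq_integral (S := Metric.closedBall 0 (2 * R))
    measurableSet_closedBall
    (by rw [Metric.isClosed_closedBall.closure_eq]; exact isCompact_closedBall _ _)
    (F := fun p => ψ (p.2 + p.1) * scaledMollifier ρ ε p.1)
    ((hψ.comp (contDiff_snd.add contDiff_fst)).mul (hρ.comp contDiff_fst))
    (s := fun s => scaledMollifier ρ ε s • SmoothFun.translate Y hψ s)
    fun _ _ => mul_comm _ _
  -- Only values near `K` matter. For `z ∈ W` both integrals extend to the whole space and agree by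
  -- the translation `y = z + s`.
  have hgg' : T.1 g = T.1 g' := by
    refine apply_eq_of_eventuallyEq hKY hT fun y hy => ?_
    filter_upwards [hW.mem_nhds (hKW hy), Y.isOpen.mem_nhds (hKY hy)] with z hz hzY
    rw [zeroExt_apply _ hzY, zeroExt_apply _ hzY, hg, hg']
    simp only
    rw [setIntegral_eq_integral_of_forall_compl_eq_zero (s := W),
      setIntegral_eq_integral_of_forall_compl_eq_zero (s := Metric.closedBall 0 (2 * R)),
      ← integral_add_left_eq_self _ z]
    · simp only [add_sub_cancel_left]
    · intro s hs
      rw [hψW, zero_mul]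
      intro hzs
      have := norm_sub_le (z + s) z
      rw [add_sub_cancel_left] at this
      rw [mem_closedBall_zero_iff] at hs
      linarith [hR _ hz, hR _ hzs]
    · intro y hy
      rw [hψW y hy, zero_mul]
  simp only [map_smul, smul_eq_mul] at hTg hTg'
  rw [← hTg, hgg', hTg', setIntegral_eq_integral_of_forall_compl_eq_zero]
  · simp only [mul_comm]
  · intro s hs
    rw [mem_closedBall_zero_iff, not_le] at hs
    rw [apply_translate_eq_zero hKY hT hW hKW hR hψ hψW hs.le, mul_zero]

end Exchange

/-! ### The commuting square. -/

section Commutation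

variable {m n : ℕ} {𝕜 : Type*} [RCLike 𝕜]
  {X : Opens (EuclideanSpace ℝ (Fin m))} {Y : Opens (EuclideanSpace ℝ (Fin n))}

/-- Where `p.2 ∉ Y` the product vanishes nearby, since `tsupport χ ⊆ Y`. Smoothness for all `y`
permits arbitrary translations. -/
theorem contDiffOn_cutoff_mul (h : SmoothFun 𝕜 (prodOpens X Y))
    {χ : EuclideanSpace ℝ (Fin n) → ℝ} (hχ : ContDiff ℝ ∞ χ) (hχY : tsupport χ ⊆ Y) :
    ContDiffOn ℝ ∞ (fun p => (χ p.2 : 𝕜) * zeroExt (h : prodOpens X Y → 𝕜) p)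
      ((X : Set (EuclideanSpace ℝ (Fin m))) ×ˢ univ) := by
  intro p hp
  refine ContDiffAt.contDiffWithinAt ?_
  by_cases hpY : p.2 ∈ Y
  · have h1 : ContDiff ℝ ∞ fun p : EuclideanSpace ℝ (Fin m) × EuclideanSpace ℝ (Fin n) =>
        (χ p.2 : 𝕜) :=
      (RCLike.ofRealCLM (K := 𝕜)).contDiff.comp (hχ.comp contDiff_snd)
    exact h1.contDiffAt.mul (contDiffAt_zeroExt h ⟨hp.1, hpY⟩)
  · have hopen : {q : EuclideanSpace ℝ (Fin m) × EuclideanSpace ℝ (Fin n) |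
        q.2 ∈ (tsupport χ)ᶜ} ∈ nhds p :=
      ((isClosed_tsupport χ).isOpen_compl.preimage continuous_snd).mem_nhds
        fun h => hpY (hχY h)
    refine (contDiffAt_const (c := (0 : 𝕜))).congr_of_eventuallyEq ?_
    filter_upwards [hopen] with q hq
    rw [image_eq_zero_of_notMem_tsupport hq]
    simp

/-- The function `(x, s) ↦ ⟨T, φ(x, · + s)⟩` is smooth. -/
theorem exists_translated_pairing (T : CompactDistribution 𝕜 Y)
    {φ : EuclideanSpace ℝ (Fin m) × EuclideanSpace ℝ (Fin n) → 𝕜}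
    (hφ : ContDiffOn ℝ ∞ φ ((X : Set (EuclideanSpace ℝ (Fin m))) ×ˢ univ)) :
    ∃ Θ : SmoothFun 𝕜 (prodOpens X (⊤ : Opens (EuclideanSpace ℝ (Fin n)))),
      ∀ (x : EuclideanSpace ℝ (Fin m)) (_ : x ∈ X) (hx : ContDiff ℝ ∞ fun y => φ (x, y)) s,
        zeroExt (Θ : prodOpens X (⊤ : Opens (EuclideanSpace ℝ (Fin n))) → 𝕜) (x, s) =
          T.1 (SmoothFun.translate Y hx s) := by
  -- The pair `(x, s)` is treated as one parameter, giving joint smoothness.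
  let k : SmoothFun 𝕜 (prodOpens (prodOpens X (⊤ : Opens (EuclideanSpace ℝ (Fin n)))) Y) :=
    SmoothFun.ofContDiffOn _ (fun q => φ (q.1.1, q.2 + q.1.2))
      (hφ.comp (by fun_prop) fun q hq => ⟨hq.1.1, mem_univ _⟩)
  refine ⟨T.pairing k, fun x hxX hx s => ?_⟩
  have hxs : (x, s) ∈ prodOpens X (⊤ : Opens (EuclideanSpace ℝ (Fin n))) := ⟨hxX, mem_univ _⟩
  rw [zeroExt_apply _ hxs, CompactDistribution.pairing_apply]
  congr 1
  refine Subtype.ext (funext fun y => ?_)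
  have hy : ((x, s), (y : EuclideanSpace ℝ (Fin n))) ∈
      prodOpens (prodOpens X (⊤ : Opens (EuclideanSpace ℝ (Fin n)))) Y := ⟨hxs, y.2⟩
  rw [kernelSlice_apply, zeroExt_apply _ hy]
  rfl

/-- The integrals of `χ h(x, ·)` against the regularizations of `T` converge to `⟨T, h(x, ·)⟩` with
an error of arbitrarily high order. -/
theorem rapidlySmall_setIntegral_cutoff {ρ : 𝓢(EuclideanSpace ℝ (Fin n), 𝕜)} (hρ : IsMollifier ρ)
    (h : SmoothFun 𝕜 (prodOpens X Y)) (T : CompactDistribution 𝕜 Y)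
    {K : Set (EuclideanSpace ℝ (Fin n))} (hKY : K ⊆ Y) {l : ℕ} {C : NNReal}
    (hT : ∀ f, ‖T.1 f‖ₑ ≤ C * semi K l f) {W : Opens (EuclideanSpace ℝ (Fin n))}
    (hW : RelCompact W Y) (hKW : K ⊆ W) {χ : EuclideanSpace ℝ (Fin n) → ℝ}
    (hχ : ContDiff ℝ ∞ χ) (hχ1 : ∀ y ∈ K, χ =ᶠ[nhds y] fun _ => 1) (hχW : tsupport χ ⊆ W)
    {L : Set (EuclideanSpace ℝ (Fin m))} (hL : IsCompact L) (hLX : L ⊆ X) :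
    RapidlySmall (fun ε x => (∫ y in (W : Set (EuclideanSpace ℝ (Fin n))),
      ((χ y : 𝕜) * zeroExt (h : prodOpens X Y → 𝕜) (x, y)) * T.1 (mollifierAt Y ρ ε y)) -
        zeroExt (T.pairing h : X → 𝕜) x) L := by
  have hφ := contDiffOn_cutoff_mul h hχ (hχW.trans hW.le)
  set φ : EuclideanSpace ℝ (Fin m) × EuclideanSpace ℝ (Fin n) → 𝕜 :=
    fun p => (χ p.2 : 𝕜) * zeroExt (h : prodOpens X Y → 𝕜) p with hφdef
  obtain ⟨Θ, hΘ⟩ := exists_translated_pairing T hφ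
  obtain ⟨R, hR⟩ := (Metric.isBounded_iff_subset_ball 0).1 (hW.1.isBounded.subset subset_closure)
  replace hR : ∀ w ∈ (W : Set (EuclideanSpace ℝ (Fin n))), ‖w‖ < R := fun w hw => by
    simpa using hR hw
  have hφx : ∀ x ∈ X, ContDiff ℝ ∞ fun y => φ (x, y) := fun x hx =>
    contDiffOn_univ.1 (hφ.comp (by fun_prop) fun y _ => ⟨hx, mem_univ _⟩)
  have hφW : ∀ x, ∀ y ∉ (W : Set (EuclideanSpace ℝ (Fin n))), φ (x, y) = 0 := fun x y hy => by
    simp [hφdef, image_eq_zero_of_notMem_tsupport fun h => hy (hχW h)]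
  -- At `s = 0` the cutoff is invisible to `T`, because `χ = 1` near `K`.
  have hΘ0 : ∀ x ∈ X,
      zeroExt (Θ : prodOpens X (⊤ : Opens (EuclideanSpace ℝ (Fin n))) → 𝕜) (x, 0) =
        zeroExt (T.pairing h : X → 𝕜) x := by
    intro x hx
    rw [hΘ x hx (hφx x hx), zeroExt_apply _ hx, CompactDistribution.pairing_apply]
    refine apply_eq_of_eventuallyEq hKY hT fun y hy => ?_
    filter_upwards [hχ1 y hy, Y.isOpen.mem_nhds (hKY hy)] with z hz hzY
    rw [zeroExt_apply _ hzY, zeroExt_apply _ hzY, kernelSlice_apply]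
    change φ (x, z + 0) = _
    simp [hφdef, hz]
  intro N
  have hLB : L ×ˢ Metric.closedBall (0 : EuclideanSpace ℝ (Fin n)) (2 * R) ⊆
      prodOpens X (⊤ : Opens (EuclideanSpace ℝ (Fin n))) := prod_mono hLX (subset_univ _)
  obtain ⟨B, hB, hΘB⟩ := exists_semi_le (hL.prod (isCompact_closedBall 0 (2 * R))) hLB (N + 1) Θ
  rw [semi_le_iff hB] at hΘB
  set A := ∫ w : EuclideanSpace ℝ (Fin n), ‖w‖ ^ (N + 1) * ‖ρ w‖
  have hA0 : 0 ≤ A := integral_nonneg fun w => by positivity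
  refine ⟨B * A, 1, by positivity, one_pos, fun ε _ x hx => ?_⟩
  have hε0 : (0 : ℝ) < ε := ε.2.1
  have hxX : x ∈ X := hLX hx
  have hθ : ContDiff ℝ ∞ fun s => zeroExt (Θ : prodOpens X (⊤ : Opens (EuclideanSpace ℝ (Fin n))) → 𝕜) (x, s) :=
    contDiffOn_univ.1 ((SmoothFun.smoothOn Θ).comp (contDiff_prodMk_right x).contDiffOn
      fun s _ => ⟨hxX, mem_univ _⟩)
  -- The Taylor estimate needs a bound for all `s`: compactness gives it on the ball of radius `2R`,
  -- uniformly in `x ∈ L`, and outside the function is locally zero.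
  have hθB : ∀ s, ‖iteratedFDeriv ℝ (N + 1)
      (fun s => zeroExt (Θ : prodOpens X (⊤ : Opens (EuclideanSpace ℝ (Fin n))) → 𝕜) (x, s)) s‖ ≤ B := by
    intro s
    by_cases hs : s ∈ Metric.closedBall (0 : EuclideanSpace ℝ (Fin n)) (2 * R)
    · exact (norm_iteratedFDeriv_partial_snd_le (prodOpens X ⊤).isOpen (SmoothFun.smoothOn Θ)
        (hLB ⟨hx, hs⟩) _).trans (hΘB (x, s) ⟨hx, hs⟩ _ le_rfl)
    · have : (fun s => zeroExt (Θ : prodOpens X (⊤ : Opens (EuclideanSpace ℝ (Fin n))) → 𝕜)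
          (x, s)) =ᶠ[nhds s] fun _ => 0 := by
        filter_upwards [Metric.isClosed_closedBall.isOpen_compl.mem_nhds hs] with t ht
        rw [mem_compl_iff, mem_closedBall_zero_iff, not_le] at ht
        rw [hΘ x hxX (hφx x hxX)]
        exact apply_translate_eq_zero hKY hT W.isOpen hKW hR _ (hφW x) ht.le
      rw [(this.iteratedFDeriv ℝ _).eq_of_nhds]
      simpa [iteratedFDeriv_fun_zero] using hB
  have key := hρ.norm_integral_mul_scaledMollifier_sub_le hθ N hθB hε0
  rw [hΘ0 x hxX] at key
  simp only [hΘ x hxX (hφx x hxX)] at key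
  rw [← setIntegral_mul_regularization_eq ρ T hKY hT W.isOpen hW.1 hKW hR (hφx x hxX) (hφW x)]
    at key
  refine key.trans ?_
  have : (ε : ℝ) ^ (N + 1) ≤ (ε : ℝ) ^ N := pow_le_pow_of_le_one hε0.le ε.2.2 (by omega)
  gcongr

/-- `1 - χ` vanishes on the neighbourhood `O` of `K`, and on the compact set `closure W \ O` the
regularizations of `T` are rapidly small. -/
theorem rapidlySmall_setIntegral_one_sub_cutoff (ρ : 𝓢(EuclideanSpace ℝ (Fin n), 𝕜))
    (h : SmoothFun 𝕜 (prodOpens X Y)) (T : CompactDistribution 𝕜 Y)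
    {K : Set (EuclideanSpace ℝ (Fin n))} (hKc : IsCompact K) (hKY : K ⊆ Y) {l : ℕ} {C : NNReal}
    (hT : ∀ f, ‖T.1 f‖ₑ ≤ C * semi K l f) {W : Opens (EuclideanSpace ℝ (Fin n))}
    (hW : RelCompact W Y) {χ : EuclideanSpace ℝ (Fin n) → ℝ}
    (hχ : ContDiff ℝ ∞ χ) (hχ1 : ∀ y ∈ K, χ =ᶠ[nhds y] fun _ => 1)
    {L : Set (EuclideanSpace ℝ (Fin m))} (hL : IsCompact L) (hLX : L ⊆ X) :
    RapidlySmall (fun ε x => ∫ y in (W : Set (EuclideanSpace ℝ (Fin n))),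
      ((1 - (χ y : 𝕜)) * zeroExt (h : prodOpens X Y → 𝕜) (x, y)) *
        T.1 (mollifierAt Y ρ ε y)) L := by
  set O := interior {y | χ y = 1} with hO
  have hKO : K ⊆ O := fun y hy => mem_interior_iff_mem_nhds.2 (hχ1 y hy)
  have hsmall := rapidlySmall_apply_mul_mollifierAt ρ hKc hKY hT 1 hKc.isClosed.isOpen_compl
    (hW.1.diff isOpen_interior) (fun y hy hyK => hy.2 (hKO hyK))
    fun y hy hyV => (hyV hy).elim
  simp only [one_mul] at hsmall
  obtain ⟨D, hD⟩ := (hL.prod hW.1).exists_bound_of_continuousOn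
    (f := fun p => (1 - (χ p.2 : 𝕜)) * zeroExt (h : prodOpens X Y → 𝕜) p) <| by
      refine ContinuousOn.mul ?_ ((SmoothFun.smoothOn h).continuousOn.mono
        (prod_subset_prodOpens hLX hW.2))
      have := hχ.continuous
      exact (continuous_const.sub
        (RCLike.continuous_ofReal.comp (this.comp continuous_snd))).continuousOn
  refine hsmall.of_le (max D 0 * volume.real (W : Set (EuclideanSpace ℝ (Fin n)))) 0
    (by positivity) ?_
  intro ε B hB hu x hx
  rw [pow_zero, inv_one, mul_one]
  refine (norm_setIntegral_le_of_norm_le_const (C := max D 0 * B) hW.volume_ne_top.lt_top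
    fun y hy => ?_).trans (le_of_eq (by ring))
  by_cases hyO : y ∈ O
  · have : y ∈ {y | χ y = 1} := interior_subset hyO
    rw [show χ y = 1 from this]
    simp only [RCLike.ofReal_one, sub_self, zero_mul, norm_zero]
    positivity
  · rw [norm_mul]
    exact mul_le_mul ((hD (x, y) ⟨hx, subset_closure hy⟩).trans (le_max_left _ _))
      (hu y ⟨subset_closure hy, hyO⟩) (norm_nonneg _) (le_max_right _ _)

/-- The classical value `x ↦ ⟨T, h(x, ·)⟩` is the generalized integral of `h` against the
regularizations of `T`. -/
theorem isParamIntegral_sigma_pairing {ρ : 𝓢(EuclideanSpace ℝ (Fin n), 𝕜)} (hρ : IsMollifier ρ)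
    (h : SmoothFun 𝕜 (prodOpens X Y)) (T : CompactDistribution 𝕜 Y) :
    IsParamIntegral (sigma h * pullSnd X (cl (regularization ρ T))) (sigma (T.pairing h)) := by
  obtain ⟨K, hKc, hKY, l, C, hT⟩ := T.2
  obtain ⟨W, hW, hKW⟩ := exists_relCompact_superset hKc hKY
  obtain ⟨χ, hχ, hχ1, hχc, hχW⟩ := exists_cutoff hKc W.isOpen hKW
  let u : Moderate 𝕜 (prodOpens X Y) := ⟨fun _ => h, isModerate_const h⟩ *
    Moderate.pull (ContinuousLinearMap.snd ℝ _ _) (fun _ hx => (mem_prod.1 hx).2)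
      (regularization ρ T)
  have hu : cl u = sigma h * pullSnd X (cl (regularization ρ T)) := rfl
  have hs : ∀ p ∈ (cl u).supp, p.2 ∈ W := fun p hp =>
    hKW (supp_cl_regularization_subset ρ T hKc hKY hT
      (snd_mem_supp_of_mem_supp_mul_pullSnd (hu ▸ hp)))
  rw [← hu, isParamIntegral_iff hW u hs]
  refine Eq.symm (cl_eq_cl_of_rapidlySmall fun L hL hLX => ?_)
  -- The integral is split by `1 = χ + (1 - χ)`; the classical value is subtracted in the `χ` part.
  refine ((rapidlySmall_setIntegral_cutoff hρ h T hKY hT hW hKW hχ hχ1 hχW hL hLX).add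
    (rapidlySmall_setIntegral_one_sub_cutoff ρ h T hKc hKY hT hW hχ hχ1 hL hLX)).congr
      fun ε x hx => ?_
  have hxX : x ∈ X := hLX hx
  have huv : ∀ y ∈ (W : Set (EuclideanSpace ℝ (Fin n))),
      zeroExt (u.1 ε : prodOpens X Y → 𝕜) (x, y) =
        zeroExt (h : prodOpens X Y → 𝕜) (x, y) * T.1 (mollifierAt Y ρ ε y) := fun y hy => by
    have hxy : (x, y) ∈ prodOpens X Y := ⟨hxX, hW.le hy⟩
    rw [← zeroExt_regularization ρ T ε (hW.le hy), zeroExt_apply _ hxy, zeroExt_apply _ hxy,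
      zeroExt_apply _ (hW.le hy)]
    rfl
  have hc1 : ContinuousOn (fun y => zeroExt (h : prodOpens X Y → 𝕜) (x, y))
      (closure (W : Set (EuclideanSpace ℝ (Fin n)))) :=
    (SmoothFun.smoothOn h).continuousOn.comp (by fun_prop) fun y hy => ⟨hxX, hW.2 hy⟩
  have hc2 : ContinuousOn (fun y => T.1 (mollifierAt Y ρ ε y))
      (closure (W : Set (EuclideanSpace ℝ (Fin n)))) :=
    ((SmoothFun.smoothOn ((regularization ρ T).1 ε)).continuousOn.mono hW.2).congr
      fun y hy => (zeroExt_regularization ρ T ε (hW.2 hy)).symm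
  have hc3 : Continuous fun y => (χ y : 𝕜) := RCLike.continuous_ofReal.comp hχ.continuous
  have hint1 := integrableOn_of_continuousOn hW.1 ((hc3.continuousOn.mul hc1).mul hc2)
  have hint2 := integrableOn_of_continuousOn hW.1
    (((continuous_const (y := (1 : 𝕜))).sub hc3).continuousOn.mul hc1 |>.mul hc2)
  change _ = zeroExt (hW.integral.pairing (u.1 ε) : X → 𝕜) x - zeroExt (T.pairing h : X → 𝕜) x
  rw [zeroExt_pairing_integral hW _ hxX, sub_add_eq_add_sub]
  congr 1
  refine (integral_add hint1 hint2).symm.trans ?_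
  refine setIntegral_congr_fun W.isOpen.measurableSet fun y hy => ?_
  rw [huv y hy]
  simp only [Pi.mul_apply, Pi.sub_apply]
  ring

end Commutation

end Colombeau

theorem mainTheorem9 {𝕜 : Type*} [RCLike 𝕜] (m n : ℕ)
    (X : TopologicalSpace.Opens (EuclideanSpace ℝ (Fin m)))
    (Y : TopologicalSpace.Opens (EuclideanSpace ℝ (Fin n)))
    (ρ : 𝓢(EuclideanSpace ℝ (Fin n), 𝕜)) (hρ : Colombeau.IsMollifier ρ)
    (h : Colombeau.SmoothFun 𝕜 (Colombeau.prodOpens X Y)) :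
    ∃ (hHat : Colombeau.CompactDistribution 𝕜 Y → Colombeau.SmoothFun 𝕜 X)
      (iS : Colombeau.CompactDistribution 𝕜 Y → Colombeau.CompactGenFun 𝕜 Y)
      (sigmaHat : Colombeau.CompactGenFun 𝕜 Y → Colombeau.GenFun 𝕜 X),
      Colombeau.IsClassicalOperator h hHat ∧
      Colombeau.IsDistributionEmbedding ρ iS ∧
      Colombeau.IsGenIntegralOperator (Colombeau.sigma h) sigmaHat ∧
      Colombeau.sigma ∘ hHat = sigmaHat ∘ iS := by
  obtain ⟨B, hB⟩ := Colombeau.exists_isGenIntegralOperator (Colombeau.sigma h)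
  refine ⟨fun T => T.pairing h,
    fun T => ⟨Colombeau.cl (Colombeau.regularization ρ T),
      Colombeau.isCompact_supp_regularization ρ T⟩, B,
    -- `kernelSlice` agrees with `slice` by definition.
    fun _ _ => rfl, fun T u => Colombeau.isEmbedded_iff ρ T u, hB, ?_⟩
  funext T
  -- Commutation is the uniqueness half of `hB`: the classical value satisfies the property
  -- characterizing the generalized integral.
  exact (hB _ _).1 (Colombeau.isParamIntegral_sigma_pairing hρ h T)
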